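/- **Conventions.** A fan $\Phi$ in a finite-dimensional real vector space $V$ is a finite set of pointed polyhedral cones with vertex $0$, containing $\{0\}$, closed under passing to faces, and such that any two of its cones intersect in a common face. It is a finite topological space whose open sets are its subfans; $[\tau]$ denotes the subfan of all faces of a cone $\tau$, and $\partial\tau$ the subfan of all proper faces of $\tau$. The sheaf $\mathcal O_\Phi$ assigns to a subfan $U$ the ring of continuous functions on $\bigcup U$ which are polynomial on each cone of $U$, graded by the degree of homogeneity (linear functions have degree $1$). A graded sheaf $\mathcal M$ of $\mathcal O_\Phi$-modules (graded by $\mathbb Z_{\ge 0}$) is *basic* if $\mathcal M([0])=\mathbb R$, in degree $0$; each $\mathcal M([\tau])$ is a graded free $\mathcal O_\Phi([\tau])$-module; $\mathcal M$ is flabby; and for each $\tau\neq 0$ no proper graded free submodule of $\mathcal M([\tau])$ is mapped onto $\mathcal M(\partial\tau)$ by the restriction. Such a sheaf exists and is unique up to isomorphism. Write $M_\Phi=\Gamma(\Phi,\mathcal M)$ and $\overline M_\Phi=M_\Phi/O_\Phi^+M_\Phi$, where $O_\Phi^+$ is the ideal of $O_\Phi=\Gamma(\Phi,\mathcal O_\Phi)$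 generated by the restrictions of the linear functionals on $V$; these spaces are graded. If $n=\dim V$ and $\Phi$ is the dual fan (the fan of outer normal cones of the faces) of a full-dimensional polytope $\Lambda\subset V^*$ with support function $S_\Lambda(\xi)=\max_{a\in\Lambda}a(\xi)\in O_\Phi$, we say that $\Phi$ satisfies *hard Lefschetz with respect to* $S_\Lambda$ if for every integer $0\le k<n/2$ multiplication by $S_\Lambda^{\,n-2k}$ is a bijection $\overline M_\Phi^k\to\overline M_\Phi^{n-k}$. **Statement.** Let $d\ge 1$, let $V$ be a $d$-dimensional real vector space, and let $\sigma\subset V$ be a polyhedral cone with nonempty interior which contains no nonzero linear subspace. Choose a vector $e$ in the interior of $\sigma$ and a linear functional $x_d$ on $V$ with $x_d(e)=1$; put $H=\{x_d=0\}$ and let $\pi(v)=v-x_d(v)e$ be the projection of $V$ onto $H$ along $e$. Let $\overline\sigma=\{\pi(\tau):\tau \text{ a proper face of }\sigma\}$ be the projected boundary fan, a complete fan in the $(d-1)$-dimensional space $H$. It is the dual fan of the polytope $\Lambda=\{a\in H^*: a(\pi(v))\le x_d(v)\ \text{for all } v\in\sigma\}$, whose support function satisfies $S_\Lambda(\pi(v))=x_d(v)$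 for all $v$ in the boundary of $\sigma$. Let $\mathcal M$ be a basic sheaf on the fan $[\sigma]$, with $M_{[\sigma]}=\Gamma([\sigma],\mathcal M)$, and identify $M_{\overline\sigma}$ with $M_{\partial\sigma}=\Gamma(\partial\sigma,\mathcal M)$ by means of $\pi$. Suppose that $\overline\sigma$ satisfies hard Lefschetz with respect to $S_\Lambda$. Then the kernel of the restriction map $M_{[\sigma]}\to M_{\partial\sigma}=M_{\overline\sigma}$ contains no nonzero homogeneous element of degree $k\le d/2$. -/

import Mathlib

open scoped NNReal

universe u w

namespace CombIH

/-! ### Fans -/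

section Fans

variable {V : Type u} [AddCommGroup V] [Module ℝ V]

/-- A fan in a real vector space: a finite collection of polyhedral cones with vertex at the
origin, containing with each cone all its faces, in which any two cones meet along a common face. -/
structure Fan (V : Type u) [AddCommGroup V] [Module ℝ V] where
  cones : Set (PointedCone ℝ V)
  finite : cones.Finite
  polyhedral : ∀ σ ∈ cones, Submodule.FG σ
  salient : ∀ σ ∈ cones, (σ : ConvexCone ℝ V).Salient
  zero_mem : ⊥ ∈ cones
  face_mem : ∀ σ ∈ cones, ∀ τ : PointedCone ℝ V, τ.IsFaceOf σ → τ ∈ cones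
  inter : ∀ σ ∈ cones, ∀ τ ∈ cones, (σ ⊓ τ).IsFaceOf σ ∧ (σ ⊓ τ).IsFaceOf τ

/-- The open sets of a fan, viewed as a finite topological space, are its subfans (including the
empty one): the subcollections closed under passing to faces. For two cones of a fan, being a face
is the same as being contained. -/
abbrev Fan.Opens (Φ : Fan V) : Type u := LowerSet Φ.cones

theorem Fan.isFaceOf_iff_le (Φ : Fan V) (τ σ : Φ.cones) :
    τ.1.IsFaceOf σ.1 ↔ τ ≤ σ := by
  refine ⟨fun h => h.le, fun h => ?_⟩
  have := (Φ.inter τ.1 τ.2 σ.1 σ.2).2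
  rwa [inf_eq_left.2 (show τ.1 ≤ σ.1 from h)] at this

/-- The minimal neighbourhood `[σ]` of a cone: the cone and all its faces. -/
def Fan.star (Φ : Fan V) (σ : Φ.cones) : Φ.Opens := LowerSet.Iic σ

/-- The boundary `∂σ` of a cone: all its proper faces. -/
def Fan.bdry (Φ : Fan V) (σ : Φ.cones) : Φ.Opens := LowerSet.Iio σ

theorem Fan.bdry_le_star (Φ : Fan V) (σ : Φ.cones) : Φ.bdry σ ≤ Φ.star σ :=
  fun _ h => LowerSet.mem_Iic_iff.2 (le_of_lt (LowerSet.mem_Iio_iff.1 h))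

/-- The zero cone as a cone of the fan. -/
def Fan.zeroCone (Φ : Fan V) : Φ.cones := ⟨⊥, Φ.zero_mem⟩

/-- The union of the cones of a subfan. -/
def Fan.supp {Φ : Fan V} (U : Φ.Opens) : Set V := {x | ∃ τ ∈ U, x ∈ τ.1}

theorem Fan.supp_mono {Φ : Fan V} {U W : Φ.Opens} (h : U ≤ W) : Fan.supp U ⊆ Fan.supp W :=
  fun _ ⟨τ, hτ, hx⟩ => ⟨τ, h hτ, hx⟩

end Fans

/-! ### Piecewise polynomial functions -/

section PiecewisePolynomial

/-- Polynomial functions on a real vector space. -/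
def polyFun (V : Type u) [AddCommGroup V] [Module ℝ V] : Subalgebra ℝ (V → ℝ) :=
  Algebra.adjoin ℝ {f | ∃ l : Module.Dual ℝ V, f = fun x => l x}

/-- Homogeneous polynomial functions of degree `k`: the span of the products of `k` linear
functionals. -/
def homPolyFun (V : Type u) [AddCommGroup V] [Module ℝ V] (k : ℕ) : Submodule ℝ (V → ℝ) :=
  Submodule.span ℝ {f | ∃ l : Fin k → Module.Dual ℝ V, f = fun x => ∏ i, l i x}

variable {V : Type u} [NormedAddCommGroup V] [NormedSpace ℝ V]

/-- The ring `O(U)` of continuous functions on the union of a subfan `U` which are polynomial on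
each cone of `U`. -/
def O {Φ : Fan V} (U : Φ.Opens) : Subalgebra ℝ C(Fan.supp U, ℝ) where
  carrier := {f | ∀ τ ∈ U, ∃ p ∈ polyFun V, ∀ x : Fan.supp U, (x : V) ∈ τ.1 → f x = p x}
  mul_mem' := by
    intro f g hf hg τ hτ
    obtain ⟨p, hp, hfp⟩ := hf τ hτ
    obtain ⟨q, hq, hgq⟩ := hg τ hτ
    exact ⟨p * q, mul_mem hp hq, fun x hx => by simp [hfp x hx, hgq x hx]⟩
  add_mem' := by
    intro f g hf hg τ hτ
    obtain ⟨p, hp, hfp⟩ := hf τ hτ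
    obtain ⟨q, hq, hgq⟩ := hg τ hτ
    exact ⟨p + q, add_mem hp hq, fun x hx => by simp [hfp x hx, hgq x hx]⟩
  algebraMap_mem' := by
    intro r τ _
    exact ⟨algebraMap ℝ (V → ℝ) r, Subalgebra.algebraMap_mem _ r, fun x _ => rfl⟩

/-- A piecewise polynomial function is homogeneous of degree `k` if it is so on each cone. -/
def O.IsHomogeneous {Φ : Fan V} {U : Φ.Opens} (f : O U) (k : ℕ) : Prop :=
  ∀ τ ∈ U, ∃ p ∈ homPolyFun V k, ∀ x : Fan.supp U, (x : V) ∈ τ.1 → f.1 x = p x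

/-- Restriction of piecewise polynomial functions to a smaller subfan. -/
def O.res {Φ : Fan V} {U W : Φ.Opens} (h : U ≤ W) : O W →ₐ[ℝ] O U :=
  AlgHom.codRestrict
    ((ContinuousMap.compRightAlgHom ℝ ℝ
      ⟨Set.inclusion (Fan.supp_mono h), continuous_inclusion (Fan.supp_mono h)⟩).comp (O W).val)
    (O U) (by
      intro f τ hτ
      obtain ⟨p, hp, hfp⟩ := f.2 τ (h hτ)
      exact ⟨p, hp, fun x hx => hfp (Set.inclusion (Fan.supp_mono h) x) hx⟩)

/-- The ideal `O⁺` of the ring of global piecewise polynomial functions which is generated by the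
global linear functions. -/
def Oplus (Φ : Fan V) : Ideal (O (⊤ : Φ.Opens)) :=
  Ideal.span {f | ∃ l : Module.Dual ℝ V, ∀ x : Fan.supp (⊤ : Φ.Opens), f.1 x = l x}

end PiecewisePolynomial

/-! ### Basic sheaves and the intersection cohomology of a fan -/

section Sheaves

variable {V : Type u} [NormedAddCommGroup V] [NormedSpace ℝ V]

/-- A graded sheaf of `O`-modules on a fan. -/
structure GradedSheaf (Φ : Fan V) where
  /-- sections over a subfan -/
  sec : Φ.Opens → Type w
  [addCommGroup : ∀ U, AddCommGroup (sec U)]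
  [module : ∀ U, Module (O U) (sec U)]
  /-- restriction maps -/
  res : ∀ {U W : Φ.Opens}, U ≤ W → sec W →+ sec U
  res_refl : ∀ (U : Φ.Opens) (m : sec U), res (le_refl U) m = m
  res_trans : ∀ {U W X : Φ.Opens} (h : U ≤ W) (h' : W ≤ X) (m : sec X),
    res h (res h' m) = res (h.trans h') m
  res_smul : ∀ {U W : Φ.Opens} (h : U ≤ W) (f : O W) (m : sec W),
    res h (f • m) = O.res h f • res h m
  /-- the sheaf axiom -/
  glue : ∀ (𝒰 : Set Φ.Opens) (s : ∀ U : 𝒰, sec U.1),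
    (∀ U W : 𝒰, res (inf_le_left : U.1 ⊓ W.1 ≤ U.1) (s U) =
      res (inf_le_right : U.1 ⊓ W.1 ≤ W.1) (s W)) →
    ∃! t : sec (sSup 𝒰), ∀ U : 𝒰, res (le_sSup U.2) t = s U
  /-- homogeneous sections of degree `k` -/
  deg : ∀ U : Φ.Opens, ℕ → AddSubgroup (sec U)
  isInternal : ∀ U : Φ.Opens, DirectSum.IsInternal (deg U)
  smul_mem_deg : ∀ {U : Φ.Opens} {i j : ℕ} (f : O U) (m : sec U),
    O.IsHomogeneous f i → m ∈ deg U j → f • m ∈ deg U (i + j)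
  res_mem_deg : ∀ {U W : Φ.Opens} (h : U ≤ W) {k : ℕ} (m : sec W),
    m ∈ deg W k → res h m ∈ deg U k

attribute [instance] GradedSheaf.addCommGroup GradedSheaf.module

namespace GradedSheaf

variable {Φ : Fan V} (M : GradedSheaf.{u, w} Φ)

/-- A linearly independent set of homogeneous sections over `U`, i.e. a homogeneous basis of the
(graded free) submodule it spans. -/
def IsHomogeneousBasisOfSpan (U : Φ.Opens) (B : Set (M.sec U)) : Prop :=
  LinearIndependent (O U) (fun b : B => (b : M.sec U)) ∧ ∀ b ∈ B, ∃ k, b ∈ M.deg U k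

/-- Basic sheaves. -/
structure IsBasic : Prop where
  /-- Normalization: the sections over the zero cone form `O([0]) = ℝ`, placed in degree `0`. -/
  normalization : Nonempty (M.sec (Φ.star Φ.zeroCone) ≃ₗ[O (Φ.star Φ.zeroCone)]
      O (Φ.star Φ.zeroCone)) ∧ M.deg (Φ.star Φ.zeroCone) 0 = ⊤
  /-- Pointwise freeness: the sections over `[σ]` form a (graded) free module. -/
  free : ∀ σ : Φ.cones, ∃ B : Set (M.sec (Φ.star σ)),
    M.IsHomogeneousBasisOfSpan (Φ.star σ) B ∧ Submodule.span (O (Φ.star σ)) B = ⊤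
  /-- Flabbiness: global sections restrict onto the sections over any subfan. -/
  flabby : ∀ U : Φ.Opens, Function.Surjective (M.res (le_top : U ≤ ⊤))
  /-- Minimality: for a nonzero cone `σ`, no graded free proper submodule of the sections over
  `[σ]` restricts onto the sections over `∂σ`. -/
  minimal : ∀ σ : Φ.cones, σ ≠ Φ.zeroCone → ∀ B : Set (M.sec (Φ.star σ)),
    M.IsHomogeneousBasisOfSpan (Φ.star σ) B →
    (∀ t : M.sec (Φ.bdry σ), ∃ m ∈ Submodule.span (O (Φ.star σ)) B,
      M.res (Φ.bdry_le_star σ) m = t) →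
    Submodule.span (O (Φ.star σ)) B = ⊤

/-- The quotient of the global sections by `O⁺` times the global sections; for a basic sheaf, this
is the intersection cohomology of the fan. -/
abbrev Coh : Type w := M.sec ⊤ ⧸ (Oplus Φ • (⊤ : Submodule (O (⊤ : Φ.Opens)) (M.sec ⊤)))

/-- The homogeneous component of degree `k` of the intersection cohomology. -/
def cohDeg (k : ℕ) : AddSubgroup M.Coh :=
  (M.deg ⊤ k).map (Submodule.mkQ (Oplus Φ • (⊤ : Submodule (O (⊤ : Φ.Opens)) (M.sec ⊤)))).toAddMonoidHom

end GradedSheaf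

/-- The Hard Lefschetz property of a (complete) fan `Φ` in an `n`-dimensional space `V`, with
respect to the support function `S ξ = max_{a ∈ Δ} ξ(a)` of a polytope `Δ` in the dual space of
`V`: if `M` is the basic sheaf of `Φ`, then for `k < n / 2` multiplication by `S ^ (n - 2 * k)` is
a bijection from the degree `k` component of the intersection cohomology onto the degree `n - k`
component. (The basic sheaf is unique up to isomorphism.) -/
def HardLefschetz (Φ : Fan V) (Δ : Set (Module.Dual ℝ V)) : Prop :=
  ∀ S : O (⊤ : Φ.Opens),
    (∀ x : Fan.supp (⊤ : Φ.Opens),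
      IsGreatest ((fun a : Module.Dual ℝ V => a x) '' Δ) (S.1 x)) →
    ∀ M : GradedSheaf.{u, w} Φ, M.IsBasic →
      ∀ k : ℕ, 2 * k < Module.finrank ℝ V →
        Set.BijOn (fun c : M.Coh => S ^ (Module.finrank ℝ V - 2 * k) • c)
          (M.cohDeg k) (M.cohDeg (Module.finrank ℝ V - k))

end Sheaves

/-! ### The fan of a single cone and its projected boundary -/

section SingleCone

section Faces

variable {V : Type u} [AddCommGroup V] [Module ℝ V]

theorem face_eq_span {σ τ : PointedCone ℝ V} (S : Finset V)
    (hS : Submodule.span ℝ≥0 (S : Set V) = σ) (h : τ.IsFaceOf σ) :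
    τ = Submodule.span ℝ≥0 ((S : Set V) ∩ τ) := by
  apply le_antisymm
  · intro x hx
    have hxσ : x ∈ Submodule.span ℝ≥0 (S : Set V) := by rw [hS]; exact h.le hx
    obtain ⟨f, -, rfl⟩ := Submodule.mem_span_finset.1 hxσ
    refine Submodule.sum_mem _ fun s hs => ?_
    rcases eq_or_ne (f s) 0 with h0 | h0
    · simp [h0]
    · refine Submodule.smul_mem _ _ (Submodule.subset_span ⟨hs, ?_⟩)
      have key := h.mem_of_sum_smul_mem (ι := S) (f := fun i => (i : V))
        (c := fun i => ((f i : ℝ≥0) : ℝ))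
        (fun i => by rw [← hS]; exact Submodule.subset_span i.2) (fun i => (f i).2)
        (by
          rw [Finset.sum_coe_sort S (fun i => ((f i : ℝ≥0) : ℝ) • i)]
          exact hx)
      exact key ⟨s, hs⟩ (by positivity)
  · exact Submodule.span_le.2 fun x hx => hx.2

theorem face_fg {σ τ : PointedCone ℝ V} (hσ : Submodule.FG σ) (h : τ.IsFaceOf σ) :
    Submodule.FG τ := by
  obtain ⟨S, hS⟩ := hσ
  rw [face_eq_span S hS h]
  exact Submodule.fg_span (S.finite_toSet.inter_of_left _)

theorem faces_finite {σ : PointedCone ℝ V} (hσ : Submodule.FG σ) :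
    {τ : PointedCone ℝ V | τ.IsFaceOf σ}.Finite := by
  obtain ⟨S, hS⟩ := hσ
  refine Set.Finite.subset ((S.finite_toSet.finite_subsets).image
    fun T : Set V => (Submodule.span ℝ≥0 T : PointedCone ℝ V)) ?_
  rintro (τ : PointedCone ℝ V) hτ
  exact ⟨(S : Set V) ∩ (τ : Set V), Set.inter_subset_left, (face_eq_span S hS hτ).symm⟩

theorem bot_isFaceOf {σ : PointedCone ℝ V} (hs : (σ : ConvexCone ℝ V).Salient) :
    (⊥ : PointedCone ℝ V).IsFaceOf σ := by
  refine PointedCone.IsFaceOf.of_mem_of_add_mem_left bot_le ?_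
  intro x y hx hy hxy
  rw [Submodule.mem_bot] at hxy ⊢
  by_contra h0
  exact hs x hx h0 (by rw [neg_eq_of_add_eq_zero_right hxy]; exact hy)

/-- The fan `[σ]` consisting of a pointed polyhedral cone and all its faces. -/
def coneFan (σ : PointedCone ℝ V) (hσ : Submodule.FG σ) (hs : (σ : ConvexCone ℝ V).Salient) :
    Fan V where
  cones := {τ | τ.IsFaceOf σ}
  finite := faces_finite hσ
  polyhedral _ h := face_fg hσ h
  salient _ h := hs.anti h.le
  zero_mem := bot_isFaceOf hs
  face_mem _ h _ h' := h'.trans h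
  inter _ h₁ _ h₂ :=
    ⟨((h₁.inf_left h₂).isFaceOf_iff_le h₁).2 inf_le_left,
      ((h₁.inf_left h₂).isFaceOf_iff_le h₂).2 inf_le_right⟩

/-- The cone `σ` as a cone of the fan `[σ]`. -/
def coneFan.self (σ : PointedCone ℝ V) (hσ : Submodule.FG σ)
    (hs : (σ : ConvexCone ℝ V).Salient) : (coneFan σ hσ hs).cones :=
  ⟨σ, PointedCone.IsFaceOf.refl σ⟩

/-- The projection `v ↦ v - ℓ(v) e` onto the hyperplane `ℓ = 0` along a vector `e` with
`ℓ(e) = 1`. -/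
def proj (l : Module.Dual ℝ V) (e : V) (hle : l e = 1) : V →ₗ[ℝ] LinearMap.ker l :=
  LinearMap.codRestrict (LinearMap.ker l) (LinearMap.id - l.smulRight e) (by
    intro v
    simp [hle])

theorem proj_apply (l : Module.Dual ℝ V) (e : V) (hle : l e = 1) (v : V) :
    ((proj l e hle v : LinearMap.ker l) : V) = v - l v • e := rfl

/-- The polytope `{a | a (proj v) ≤ ℓ(v) for all v ∈ σ}` in the dual of the hyperplane `ℓ = 0`.
The support function of this polytope, evaluated at the projection of a boundary point `v` of `σ`,
is `ℓ(v)`. -/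
def linkPolytope (σ : PointedCone ℝ V) (l : Module.Dual ℝ V) (e : V) (hle : l e = 1) :
    Set (Module.Dual ℝ (LinearMap.ker l)) :=
  {a | ∀ v ∈ σ, a (proj l e hle v) ≤ l v}

end Faces

variable {V : Type u} [NormedAddCommGroup V] [NormedSpace ℝ V]

theorem face_eq_of_interior {σ τ : PointedCone ℝ V} (h : τ.IsFaceOf σ) {a : V}
    (ha : a ∈ interior (σ : Set V)) (haτ : a ∈ τ) : τ = σ := by
  refine le_antisymm h.le fun y hy => ?_
  have hc : Filter.Tendsto (fun t : ℝ => a - t • y) (nhdsWithin 0 (Set.Ioi 0)) (nhds a) := by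
    have : Continuous fun t : ℝ => a - t • y := by fun_prop
    have h0 := (this.tendsto 0).mono_left (nhdsWithin_le_nhds (s := Set.Ioi (0 : ℝ)))
    simpa using h0
  have hev := hc.eventually (isOpen_interior.mem_nhds ha)
  obtain ⟨t, ht, htpos⟩ := (hev.and self_mem_nhdsWithin).exists
  have ht' : a - t • y ∈ σ := interior_subset ht
  refine h.mem_of_smul_add_mem hy ht' (show (0 : ℝ) < t from htpos) ?_
  rwa [add_sub_cancel]

/-- Moving from a point of a proper face in the direction of an interior vector never leads to a
point of a proper face. -/
theorem not_mem_face_add {σ τ₁ τ₂ : PointedCone ℝ V} (h₁ : τ₁ ≤ σ) (h₂ : τ₂.IsFaceOf σ)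
    (hne : τ₂ ≠ σ) {e : V} (he : e ∈ interior (σ : Set V)) {a b : V} (ha : a ∈ τ₁) (hb : b ∈ τ₂)
    {s : ℝ} (hs : 0 < s) (hab : b = a + s • e) : False := by
  apply hne
  refine face_eq_of_interior h₂ he ?_
  refine h₂.mem_of_smul_add_mem (interior_subset he) (h₁ ha) hs ?_
  rw [add_comm, ← hab]
  exact hb

theorem proj_injOn {σ τ₁ τ₂ : PointedCone ℝ V} (h₁ : τ₁.IsFaceOf σ) (hne₁ : τ₁ ≠ σ)
    (h₂ : τ₂.IsFaceOf σ) (hne₂ : τ₂ ≠ σ) {l : Module.Dual ℝ V} {e : V}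
    (he : e ∈ interior (σ : Set V)) (hle : l e = 1) {a b : V} (ha : a ∈ τ₁) (hb : b ∈ τ₂)
    (hab : proj l e hle a = proj l e hle b) : a = b := by
  have h : a - l a • e = b - l b • e := congrArg Subtype.val hab
  have h' : b = a + (l b - l a) • e := by
    rw [sub_smul]
    calc b = (b - l b • e) + l b • e := by abel
      _ = (a - l a • e) + l b • e := by rw [h]
      _ = a + (l b • e - l a • e) := by abel
  rcases lt_trichotomy (l b - l a) 0 with hlt | heq | hgt
  · refine (not_mem_face_add h₂.le h₁ hne₁ he hb ha (neg_pos.2 hlt) ?_).elim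
    rw [neg_smul, ← sub_eq_add_neg]
    exact eq_sub_of_add_eq h'.symm
  · rw [heq, zero_smul, add_zero] at h'
    exact h'.symm
  · exact (not_mem_face_add h₁.le h₂ hne₂ he ha hb hgt h').elim

theorem map_proj_isFaceOf {σ τ τ' : PointedCone ℝ V} (h : τ.IsFaceOf σ) (hne : τ ≠ σ)
    (h' : τ'.IsFaceOf τ) {l : Module.Dual ℝ V} {e : V}
    (he : e ∈ interior (σ : Set V)) (hle : l e = 1) :
    (τ'.map (proj l e hle)).IsFaceOf (τ.map (proj l e hle)) := by
  refine PointedCone.IsFaceOf.of_mem_of_add_mem_left (Submodule.map_mono h'.le) ?_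
  rintro x y hx hy hxy
  obtain ⟨a, ha, rfl⟩ := PointedCone.mem_map.1 hx
  obtain ⟨b, hb, rfl⟩ := PointedCone.mem_map.1 hy
  obtain ⟨c, hc, hcab⟩ := PointedCone.mem_map.1 hxy
  rw [← map_add] at hcab
  have : c = a + b := proj_injOn h hne h hne he hle (h'.le hc) (add_mem ha hb) hcab
  exact PointedCone.mem_map.2 ⟨a, h'.mem_of_add_mem_left ha hb (this ▸ hc), rfl⟩

theorem map_proj_inf {σ τ₁ τ₂ : PointedCone ℝ V} (h₁ : τ₁.IsFaceOf σ) (hne₁ : τ₁ ≠ σ)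
    (h₂ : τ₂.IsFaceOf σ) (hne₂ : τ₂ ≠ σ) {l : Module.Dual ℝ V} {e : V}
    (he : e ∈ interior (σ : Set V)) (hle : l e = 1) :
    τ₁.map (proj l e hle) ⊓ τ₂.map (proj l e hle) = (τ₁ ⊓ τ₂).map (proj l e hle) := by
  apply le_antisymm
  · rintro x ⟨hx₁, hx₂⟩
    obtain ⟨a, ha, rfl⟩ := PointedCone.mem_map.1 hx₁
    obtain ⟨b, hb, hba⟩ := PointedCone.mem_map.1 hx₂
    have : b = a := proj_injOn h₂ hne₂ h₁ hne₁ he hle hb ha hba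
    subst this
    exact PointedCone.mem_map.2 ⟨b, ⟨ha, hb⟩, rfl⟩
  · exact le_inf (Submodule.map_mono inf_le_left) (Submodule.map_mono inf_le_right)

/-- The projected boundary fan `σ̄` of a full-dimensional pointed polyhedral cone `σ`: the images
of the proper faces of `σ` under the projection onto the hyperplane `ℓ = 0` along an interior
vector `e` of `σ` with `ℓ(e) = 1`. -/
def boundaryFan (σ : PointedCone ℝ V) (hσ : Submodule.FG σ)
    (hs : (σ : ConvexCone ℝ V).Salient) (l : Module.Dual ℝ V) (e : V)
    (he : e ∈ interior (σ : Set V)) (hle : l e = 1) : Fan (LinearMap.ker l) where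
  cones := (fun τ : PointedCone ℝ V => τ.map (proj l e hle)) '' {τ | τ.IsFaceOf σ ∧ τ ≠ σ}
  finite := ((faces_finite hσ).subset fun _ h => h.1).image _
  polyhedral := by
    rintro _ ⟨τ, ⟨h, -⟩, rfl⟩
    exact (face_fg hσ h).map _
  salient := by
    rintro _ ⟨τ, ⟨h, hne⟩, rfl⟩ x hx hx0 hnx
    obtain ⟨a, ha, rfl⟩ := PointedCone.mem_map.1 hx
    obtain ⟨b, hb, hba⟩ := PointedCone.mem_map.1 hnx
    have hab : a + b = 0 := proj_injOn h hne h hne he hle (add_mem ha hb) (zero_mem τ)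
      (by rw [map_add, hba, map_zero, add_neg_cancel])
    refine hs a (h.le ha) (fun h0 => hx0 (by rw [h0, map_zero])) ?_
    rw [neg_eq_of_add_eq_zero_right hab]
    exact h.le hb
  zero_mem := by
    refine ⟨⊥, ⟨bot_isFaceOf hs, fun h => ?_⟩, Submodule.map_bot _⟩
    have he' : e ∈ (⊥ : PointedCone ℝ V) := by rw [h]; exact interior_subset he
    rw [Submodule.mem_bot] at he'
    simp [he'] at hle
  face_mem := by
    rintro _ ⟨τ, ⟨h, hne⟩, rfl⟩ ρ hρ
    have hf : (τ ⊓ ρ.comap (proj l e hle)).IsFaceOf τ := by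
      refine PointedCone.IsFaceOf.of_mem_of_add_mem_left inf_le_left ?_
      rintro x y hx hy ⟨-, hxy⟩
      refine ⟨hx, ?_⟩
      have hxy' : proj l e hle x + proj l e hle y ∈ ρ := by rw [← map_add]; exact hxy
      exact hρ.mem_of_add_mem_left (PointedCone.mem_map.2 ⟨x, hx, rfl⟩)
        (PointedCone.mem_map.2 ⟨y, hy, rfl⟩) hxy'
    refine ⟨τ ⊓ ρ.comap (proj l e hle), ⟨hf.trans h, fun heq => hne ?_⟩, ?_⟩
    · exact le_antisymm h.le (heq ▸ inf_le_left)
    · apply le_antisymm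
      · rintro _ ⟨x, ⟨-, hx⟩, rfl⟩
        exact hx
      · intro y hy
        obtain ⟨x, hx, rfl⟩ := PointedCone.mem_map.1 (hρ.le hy)
        exact PointedCone.mem_map.2 ⟨x, ⟨hx, hy⟩, rfl⟩
  inter := by
    rintro _ ⟨τ₁, ⟨h₁, hne₁⟩, rfl⟩ _ ⟨τ₂, ⟨h₂, hne₂⟩, rfl⟩
    have hf := h₁.inf_left h₂
    dsimp only
    rw [map_proj_inf h₁ hne₁ h₂ hne₂ he hle]
    exact ⟨map_proj_isFaceOf h₁ hne₁ ((hf.isFaceOf_iff_le h₁).2 inf_le_left) he hle,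
      map_proj_isFaceOf h₂ hne₂ ((hf.isFaceOf_iff_le h₂).2 inf_le_right) he hle⟩

end SingleCone

end CombIH

/-!
The idea is to compare the sections `M(σ)` over the cone with their restrictions to the boundary
`∂σ` as modules over the ring `B` of polynomials on the hyperplane `H`, of dimension `n = d - 1`,
which act through the projection along `e`. The functions on `σ` form the polynomial ring `B[ℓ]`,
and the functional `ℓ` acts on the sections over the boundary as the support function `S` of the
polytope `Λ` (`exists_supportFunction`).

*The sections over the boundary form a projective `B`-module* (`projective_bdry`). The boundary is
shelled along a line: the part of the boundary of a cone `τ` which is visible from a point is the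
union of a facet and of a smaller visible part, and these two meet in a visible part of the
boundary of the facet (`exists_shelling_step`). The sections over a face `F` are free over the ring
of polynomial functions on the span of `F`, so their projective dimension over `B` is at most
`n - dim F`, and the exact sequences coming from gluing bound the projective dimension of the
sections over visible parts by induction on the dimension and on the number of visible faces
(`pdLT_visibleFan`). From `-e` all proper faces of `σ` are visible, and the bound becomes zero.

*Independence can be tested at the origin.* In a projective `B`-module, a family whose residues
modulo the ideal `B⁺` of polynomials without constant term are linearly independent over `ℝ` is
linearly independent over `B` (`linearIndependent_of_projective`): compare the coefficients of a
monomial of lowest degree in a relation.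

*Independence of the restricted generators.* Let `E` be a homogeneous basis of `M(σ)` over `B[ℓ]`,
and let `ρ` be the restriction to the boundary. A section of degree `k` is a combination over `B`
of the products `ℓ ^ j • ε` with `ε ∈ E` and `deg ε + j ≤ k` (`mem_span_pow_smul_of_mem_deg`). If
`2 * k ≤ n + 1`, then the restrictions `S ^ j • ρ ε` of these products are linearly independent
modulo `B⁺` (`eq_zero_of_sum_mem_bdryAug`). Indeed, take a homogeneous relation of degree `q`, and
let `P` be the largest degree of a generator that occurs in it. The relation has the form
`S ^ (q - P) • y ≡ 0` with `y` of degree `P`, where `q - P ≤ n - 2 * P` unless `q = P`, so the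
injectivity in hard Lefschetz yields `y ≡ 0`. Hence a combination of the `ρ ε` with `ε` of degree
`P` is zero modulo `B⁺` and `S`, that is, a combination of products of linear functionals with
restrictions of sections of smaller degree. Then one of the generators of degree `P` could be
dropped without changing the image of the restriction, contrary to the minimality of the sheaf
(`eq_zero_of_sum_mem_sup`).

Thus the products `ℓ ^ j • ε` with `deg ε + j ≤ k` have `B`-independent restrictions, and no
nonzero combination of them, in particular no nonzero section of degree `k`, vanishes on the
boundary.
-/

namespace CombIH

/-! ### Polyhedral cones and their facets -/

section Cones

variable {V : Type u} [AddCommGroup V] [Module ℝ V]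

open Module

/-- Fourier–Motzkin elimination of one variable from a finite system of linear inequalities. -/
theorem exists_finset_dual_of_exists_sub_smul (U : Finset (Dual ℝ V)) (w : V) :
    ∃ U' : Finset (Dual ℝ V), ∀ x,
      (∃ t : ℝ, 0 ≤ t ∧ ∀ u ∈ U, 0 ≤ u (x - t • w)) ↔ ∀ u ∈ U', 0 ≤ u x := by
  classical
  refine ⟨U.filter (fun u => 0 ≤ u w) ∪
    Finset.image₂ (fun u u' : Dual ℝ V => u w • u' - u' w • u)
      (U.filter (fun u => 0 ≤ u w)) (U.filter (fun u => u w < 0)), fun x => ⟨?_, fun h => ?_⟩⟩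
  · rintro ⟨t, ht, h⟩ u hu
    simp only [map_sub, map_smul, smul_eq_mul] at h
    rcases Finset.mem_union.1 hu with hu | hu
    · rw [Finset.mem_filter] at hu
      have := mul_nonneg ht hu.2
      linarith [h u hu.1]
    · obtain ⟨a, ha, b, hb, rfl⟩ := Finset.mem_image₂.1 hu
      rw [Finset.mem_filter] at ha hb
      simp only [LinearMap.sub_apply, LinearMap.smul_apply, smul_eq_mul]
      have h1 := mul_nonneg ha.2 (h b hb.1)
      have h2 := mul_nonneg (neg_nonneg.2 hb.2.le) (h a ha.1)
      linarith
  · have hpos : ∀ u ∈ U, 0 ≤ u w → 0 ≤ u x := fun u hu hw =>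
      h u (Finset.mem_union_left _ (Finset.mem_filter.2 ⟨hu, hw⟩))
    have hmix : ∀ a ∈ U, 0 ≤ a w → ∀ b ∈ U, b w < 0 → 0 ≤ a w * b x - b w * a x :=
      fun a ha haw b hb hbw => h (a w • b - b w • a) (Finset.mem_union_right _
        (Finset.mem_image₂.2 ⟨a, Finset.mem_filter.2 ⟨ha, haw⟩, b, Finset.mem_filter.2 ⟨hb, hbw⟩,
          rfl⟩))
    simp only [map_sub, map_smul, smul_eq_mul]
    rcases (U.filter (fun u => u w < 0)).eq_empty_or_nonempty with hT | hT
    · refine ⟨0, le_rfl, fun u hu => ?_⟩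
      have : 0 ≤ u w := by
        by_contra hlt
        have : u ∈ U.filter (fun u => u w < 0) := Finset.mem_filter.2 ⟨hu, not_le.1 hlt⟩
        simp [hT] at this
      simpa using hpos u hu this
    · obtain ⟨b, hb, hmax⟩ := Finset.exists_max_image _ (fun u : Dual ℝ V => u x / u w) hT
      rw [Finset.mem_filter] at hb
      refine ⟨max 0 (b x / b w), le_max_left _ _, fun u hu => ?_⟩
      rcases lt_or_ge (u w) 0 with hw | hw
      · have h1 := (hmax u (Finset.mem_filter.2 ⟨hu, hw⟩)).trans (le_max_right 0 _)
        have h2 := (div_le_iff_of_neg hw).1 h1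
        linarith
      · rcases max_choice 0 (b x / b w) with h0 | h0 <;> rw [h0]
        · simpa using hpos u hu hw
        · have h1 := hmix u hu hw b hb.1 hb.2
          have : b x / b w * u w = (u w * b x) / b w := by ring
          rw [this, sub_nonneg, div_le_iff_of_neg hb.2]
          linarith

/-- A finitely generated cone is an intersection of finitely many closed half-spaces. -/
theorem exists_finset_dual_of_fg [FiniteDimensional ℝ V] {σ : PointedCone ℝ V}
    (hσ : Submodule.FG σ) :
    ∃ U : Finset (Dual ℝ V), ∀ x, x ∈ σ ↔ ∀ u ∈ U, 0 ≤ u x := by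
  classical
  obtain ⟨S, rfl⟩ := hσ
  induction S using Finset.induction_on with
  | empty =>
    let b := finBasis ℝ V
    refine ⟨Finset.univ.image b.coord ∪ Finset.univ.image (fun i => -b.coord i), fun x => ?_⟩
    simp only [Finset.coe_empty, Submodule.span_empty, Submodule.mem_bot, Finset.mem_union,
      Finset.mem_image, Finset.mem_univ, true_and]
    refine ⟨by rintro rfl; simp, fun h => b.ext_elem fun i => ?_⟩
    have h1 := h _ (Or.inl ⟨i, rfl⟩)
    have h2 := h _ (Or.inr ⟨i, rfl⟩)
    simp only [LinearMap.neg_apply, Basis.coord_apply] at h1 h2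
    simp only [map_zero, Finsupp.coe_zero, Pi.zero_apply]
    linarith
  | insert w S _ ih =>
    obtain ⟨U, hU⟩ := ih
    obtain ⟨U', hU'⟩ := exists_finset_dual_of_exists_sub_smul U w
    refine ⟨U', fun x => ?_⟩
    rw [← hU', Finset.coe_insert, Submodule.mem_span_insert]
    constructor
    · rintro ⟨a, z, hz, rfl⟩
      refine ⟨a, a.2, (hU _).1 ?_⟩
      rw [show (a : ℝ) • w = a • w from rfl, add_sub_cancel_left]
      exact hz
    · rintro ⟨t, ht, h⟩
      refine ⟨⟨t, ht⟩, x - t • w, (hU _).2 h, ?_⟩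
      rw [show (⟨t, ht⟩ : ℝ≥0) • w = t • w from rfl]
      abel

theorem smul_mem_cone {σ : PointedCone ℝ V} {t : ℝ} (ht : 0 ≤ t) {x : V} (hx : x ∈ σ) :
    t • x ∈ σ :=
  Submodule.smul_mem σ (⟨t, ht⟩ : ℝ≥0) hx

theorem exists_sub_of_mem_span {τ : PointedCone ℝ V} {x : V}
    (hx : x ∈ Submodule.span ℝ (τ : Set V)) : ∃ a ∈ τ, ∃ b ∈ τ, x = a - b := by
  induction hx using Submodule.span_induction with
  | mem x h => exact ⟨x, h, 0, zero_mem _, by simp⟩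
  | zero => exact ⟨0, zero_mem _, 0, zero_mem _, by simp⟩
  | add x y _ _ hx hy =>
    obtain ⟨a, ha, b, hb, rfl⟩ := hx
    obtain ⟨c, hc, d, hd, rfl⟩ := hy
    exact ⟨a + c, add_mem ha hc, b + d, add_mem hb hd, by abel⟩
  | smul t x _ hx =>
    obtain ⟨a, ha, b, hb, rfl⟩ := hx
    rcases le_total 0 t with ht | ht
    · exact ⟨t • a, smul_mem_cone ht ha, t • b, smul_mem_cone ht hb, smul_sub _ _ _⟩
    · refine ⟨(-t) • b, smul_mem_cone (neg_nonneg.2 ht) hb, (-t) • a,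
        smul_mem_cone (neg_nonneg.2 ht) ha, ?_⟩
      module

/-- A face is cut out of the cone by its linear span. -/
theorem mem_face_of_mem_span {σ τ : PointedCone ℝ V} (h : τ.IsFaceOf σ) {x : V} (hx : x ∈ σ)
    (hxs : x ∈ Submodule.span ℝ (τ : Set V)) : x ∈ τ := by
  obtain ⟨a, ha, b, hb, rfl⟩ := exists_sub_of_mem_span hxs
  exact h.mem_of_add_mem_left hx (h.le hb) (by simpa using ha)

/-- An irredundant description of a cone inside its linear span by finitely many linear
inequalities; its members are the functionals of the facets of the cone. -/
structure IsFacetSystem (τ : PointedCone ℝ V) (U : Finset (Dual ℝ V)) : Prop where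
  mem_iff : ∀ x ∈ Submodule.span ℝ (τ : Set V), x ∈ τ ↔ ∀ u ∈ U, 0 ≤ u x
  irredundant : ∀ u ∈ U, ∃ y ∈ Submodule.span ℝ (τ : Set V), u y < 0 ∧
    ∀ u' ∈ U, u' ≠ u → 0 ≤ u' y

/-- A description by as few inequalities as possible is irredundant. -/
theorem exists_isFacetSystem [FiniteDimensional ℝ V] {τ : PointedCone ℝ V}
    (hτ : Submodule.FG τ) : ∃ U, IsFacetSystem τ U := by
  classical
  let P : ℕ → Prop := fun n => ∃ U : Finset (Dual ℝ V), U.card = n ∧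
    ∀ x ∈ Submodule.span ℝ (τ : Set V), x ∈ τ ↔ ∀ u ∈ U, 0 ≤ u x
  have hP : ∃ n, P n := by
    obtain ⟨U, hU⟩ := exists_finset_dual_of_fg hτ
    exact ⟨_, U, rfl, fun x _ => hU x⟩
  obtain ⟨U, hc, hU⟩ := Nat.find_spec hP
  refine ⟨U, hU, fun u hu => ?_⟩
  by_contra! hcon
  have hlt : (U.erase u).card < Nat.find hP := by
    rw [← hc]; exact Finset.card_erase_lt_of_mem hu
  refine Nat.find_min hP hlt ⟨_, rfl, fun x hx => ⟨fun h v hv => (hU x hx).1 h v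
    (Finset.mem_of_mem_erase hv), fun h => (hU x hx).2 fun v hv => ?_⟩⟩
  rcases eq_or_ne v u with rfl | hne
  · by_contra hlt
    obtain ⟨v', hv', hne', hlt'⟩ := hcon x hx (not_le.1 hlt)
    exact absurd (h v' (Finset.mem_erase.2 ⟨hne', hv'⟩)) (not_le.2 hlt')
  · exact h v (Finset.mem_erase.2 ⟨hne, hv⟩)

/-- A point at which finitely many functionals are positive can be moved a little in any
direction. -/
theorem exists_pos_forall_add_smul (U : Finset (Dual ℝ V)) (x y : V)
    (h : ∀ u ∈ U, 0 < u x ∨ (u x = 0 ∧ 0 ≤ u y)) :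
    ∃ t : ℝ, 0 < t ∧ ∀ s : ℝ, 0 ≤ s → s ≤ t → ∀ u ∈ U, 0 ≤ u (x + s • y) := by
  classical
  induction U using Finset.induction_on with
  | empty => exact ⟨1, one_pos, by simp⟩
  | insert u U _ ih =>
    obtain ⟨t, ht, hU⟩ := ih fun v hv => h v (Finset.mem_insert_of_mem hv)
    obtain ⟨r, hr, hu⟩ : ∃ r : ℝ, 0 < r ∧ ∀ s : ℝ, 0 ≤ s → s ≤ r → 0 ≤ u (x + s • y) := by
      simp only [map_add, map_smul, smul_eq_mul]
      rcases h u (Finset.mem_insert_self _ _) with hp | ⟨h0, hn⟩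
      · refine ⟨u x / (|u y| + 1), by positivity, fun s hs hsr => ?_⟩
        rw [le_div_iff₀ (by positivity)] at hsr
        have := mul_le_mul_of_nonneg_left (neg_abs_le (u y)) hs
        linarith
      · exact ⟨1, one_pos, fun s hs _ => by rw [h0]; positivity⟩
    refine ⟨min t r, lt_min ht hr, fun s hs hst v hv => ?_⟩
    rcases Finset.mem_insert.1 hv with rfl | hv
    · exact hu s hs (hst.trans (min_le_right _ _))
    · exact hU s hs (hst.trans (min_le_left _ _)) v hv

variable {τ : PointedCone ℝ V} {U : Finset (Dual ℝ V)}

theorem IsFacetSystem.nonneg (h : IsFacetSystem τ U) {x : V} (hx : x ∈ τ) {u : Dual ℝ V}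
    (hu : u ∈ U) : 0 ≤ u x :=
  (h.mem_iff x (Submodule.subset_span hx)).1 hx u hu

/-- If each functional of a subset of a facet system is positive somewhere on a subcone, all of
them are positive at a common point. -/
theorem IsFacetSystem.exists_forall_pos (h : IsFacetSystem τ U) {ρ : PointedCone ℝ V} (hρ : ρ ≤ τ)
    (U' : Finset (Dual ℝ V)) (hU' : U' ⊆ U) (hpos : ∀ u ∈ U', ∃ x ∈ ρ, 0 < u x) :
    ∃ x ∈ ρ, ∀ u ∈ U', 0 < u x := by
  classical
  induction U' using Finset.induction_on with
  | empty => exact ⟨0, zero_mem _, by simp⟩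
  | insert u U' _ ih =>
    obtain ⟨x, hx, hxp⟩ := ih (fun v hv => hU' (Finset.mem_insert_of_mem hv))
      fun v hv => hpos v (Finset.mem_insert_of_mem hv)
    obtain ⟨y, hy, hyp⟩ := hpos u (Finset.mem_insert_self _ _)
    refine ⟨x + y, add_mem hx hy, fun v hv => ?_⟩
    rw [map_add]
    rcases Finset.mem_insert.1 hv with rfl | hv'
    · exact add_pos_of_nonneg_of_pos (h.nonneg (hρ hx) (hU' hv)) hyp
    · exact add_pos_of_pos_of_nonneg (hxp v hv') (h.nonneg (hρ hy) (hU' hv))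

/-- A point in the relative interior of a cone. -/
theorem IsFacetSystem.exists_mem_forall_pos (h : IsFacetSystem τ U) :
    ∃ x ∈ τ, ∀ u ∈ U, 0 < u x := by
  refine h.exists_forall_pos le_rfl U subset_rfl fun u hu => ?_
  obtain ⟨y, hy, hneg, -⟩ := h.irredundant u hu
  obtain ⟨a, ha, b, hb, rfl⟩ := exists_sub_of_mem_span hy
  refine ⟨b, hb, ?_⟩
  have := h.nonneg ha hu
  rw [map_sub] at hneg
  linarith

/-- The face of a cone on which a functional vanishes. -/
def kerFace (τ : PointedCone ℝ V) (u : Dual ℝ V) : PointedCone ℝ V :=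
  τ ⊓ (LinearMap.ker u).restrictScalars ℝ≥0

theorem IsFacetSystem.kerFace_isFaceOf (h : IsFacetSystem τ U) {u : Dual ℝ V} (hu : u ∈ U) :
    (kerFace τ u).IsFaceOf τ := by
  refine PointedCone.IsFaceOf.of_mem_of_add_mem_left inf_le_left ?_
  intro x y hx hy hxy
  refine ⟨hx, ?_⟩
  have h0 : u x + u y = 0 := by rw [← map_add]; exact hxy.2
  have hx0 := h.nonneg hx hu
  have hy0 := h.nonneg hy hu
  exact le_antisymm (by linarith) hx0

/-- The relative interior of a facet: the other facet functionals are positive there. -/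
theorem IsFacetSystem.exists_mem_kerFace (h : IsFacetSystem τ U) {u : Dual ℝ V} (hu : u ∈ U) :
    ∃ z ∈ kerFace τ u, ∀ u' ∈ U, u' ≠ u → 0 < u' z := by
  obtain ⟨e, he, hpos⟩ := h.exists_mem_forall_pos
  obtain ⟨y, hy, hneg, hnn⟩ := h.irredundant u hu
  -- the point of the segment from `e` to `y` at which `u` vanishes, up to a positive factor
  have hz0 : u (u e • y - u y • e) = 0 := by simp; ring
  have hzp : ∀ u' ∈ U, u' ≠ u → 0 < u' (u e • y - u y • e) := by
    intro u' hu' hne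
    simp only [map_sub, map_smul, smul_eq_mul]
    have h1 := mul_nonneg (hpos u hu).le (hnn u' hu' hne)
    have h2 := mul_pos (neg_pos.2 hneg) (hpos u' hu')
    linarith
  refine ⟨_, ⟨(h.mem_iff _ ?_).2 fun u' hu' => ?_, hz0⟩, hzp⟩
  · exact sub_mem (Submodule.smul_mem _ _ hy)
      (Submodule.smul_mem _ _ (Submodule.subset_span he))
  · rcases eq_or_ne u' u with rfl | hne
    · exact hz0.ge
    · exact (hzp u' hu' hne).le

theorem IsFacetSystem.span_kerFace (h : IsFacetSystem τ U) {u : Dual ℝ V} (hu : u ∈ U) :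
    Submodule.span ℝ (kerFace τ u : Set V) =
      Submodule.span ℝ (τ : Set V) ⊓ LinearMap.ker u := by
  apply le_antisymm
  · exact Submodule.span_le.2 fun x hx => ⟨Submodule.subset_span hx.1, hx.2⟩
  · rintro x ⟨hx, hx0⟩
    obtain ⟨z, hz, hzp⟩ := h.exists_mem_kerFace hu
    obtain ⟨t, ht, hU⟩ := exists_pos_forall_add_smul U z x fun u' hu' => by
      rcases eq_or_ne u' u with rfl | hne
      · exact Or.inr ⟨hz.2, hx0.ge⟩
      · exact Or.inl (hzp u' hu' hne)
    have hmem : z + t • x ∈ kerFace τ u := by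
      refine ⟨(h.mem_iff _ ?_).2 (hU t ht.le le_rfl), ?_⟩
      · exact add_mem (Submodule.subset_span hz.1) (Submodule.smul_mem _ _ hx)
      · exact add_mem (show z ∈ LinearMap.ker u from hz.2) (Submodule.smul_mem _ _ hx0)
    have h2 : x = t⁻¹ • ((z + t • x) - z) := by
      rw [add_sub_cancel_left, smul_smul, inv_mul_cancel₀ ht.ne', one_smul]
    rw [h2]
    exact Submodule.smul_mem _ _ (sub_mem (Submodule.subset_span hmem)
      (Submodule.subset_span hz))

theorem IsFacetSystem.finrank_span_kerFace [FiniteDimensional ℝ V] (h : IsFacetSystem τ U)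
    {u : Dual ℝ V} (hu : u ∈ U) :
    finrank ℝ (Submodule.span ℝ (kerFace τ u : Set V)) + 1 =
      finrank ℝ (Submodule.span ℝ (τ : Set V)) := by
  set L := Submodule.span ℝ (τ : Set V)
  have hne : u.domRestrict L ≠ 0 := by
    obtain ⟨y, hy, hneg, -⟩ := h.irredundant u hu
    intro h0
    have := LinearMap.congr_fun h0 ⟨y, hy⟩
    simp only [LinearMap.domRestrict_apply, LinearMap.zero_apply] at this
    exact hneg.ne this
  have h1 := Module.Dual.finrank_ker_add_one_of_ne_zero hne
  rw [← h1, h.span_kerFace hu, LinearMap.ker_domRestrict]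
  congr 1
  rw [← Submodule.finrank_map_subtype_eq, Submodule.map_comap_subtype]

/-! ### Visible faces and shelling -/

/-- A face `ρ` of the cone `τ` is visible from `v` if moving from a point of `ρ` in the direction
of `v` leaves `τ` at once. -/
def Visible (τ : PointedCone ℝ V) (v : V) (ρ : PointedCone ℝ V) : Prop :=
  ∀ x ∈ ρ, ∀ s : ℝ, 0 < s → x + s • v ∉ τ

theorem Visible.anti {v : V} {ρ ρ' : PointedCone ℝ V} (h : ρ' ≤ ρ) (hv : Visible τ v ρ) :
    Visible τ v ρ' :=
  fun x hx => hv x (h hx)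

theorem not_visible_of_mem {v : V} (hv : v ∈ τ) {ρ : PointedCone ℝ V} : ¬ Visible τ v ρ := by
  intro h
  refine h 0 (zero_mem _) 1 one_pos ?_
  simpa using hv

/-- A face is not visible from a point of its linear span. -/
theorem not_visible_of_mem_span {v : V} {ρ : PointedCone ℝ V} (hρ : ρ ≤ τ)
    (hv : v ∈ Submodule.span ℝ (ρ : Set V)) : ¬ Visible τ v ρ := by
  obtain ⟨a, ha, b, hb, rfl⟩ := exists_sub_of_mem_span hv
  intro h
  refine h b hb 1 one_pos (hρ ?_)
  simpa using ha

/-- From a point of the linear span of a face `τ`, the same faces of `τ` are visible on `τ` and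
on the whole cone. -/
theorem visible_iff_of_mem_span {σ : PointedCone ℝ V} (h : τ.IsFaceOf σ) {v : V}
    (hv : v ∈ Submodule.span ℝ (τ : Set V)) {ρ : PointedCone ℝ V} (hρ : ρ ≤ τ) :
    Visible σ v ρ ↔ Visible τ v ρ := by
  refine ⟨fun hV x hx s hs hm => hV x hx s hs (h.le hm), fun hV x hx s hs hm => ?_⟩
  exact hV x hx s hs (mem_face_of_mem_span h hm
    (add_mem (Submodule.subset_span (hρ hx)) (Submodule.smul_mem _ _ hv)))

/-- All proper faces are visible from the negative of an interior point. -/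
theorem visible_neg_iff {σ ρ : PointedCone ℝ V} (hρ : ρ.IsFaceOf σ) {e : V} (he : e ∈ σ)
    (hint : ∀ τ : PointedCone ℝ V, τ.IsFaceOf σ → e ∈ τ → τ = σ) :
    Visible σ (-e) ρ ↔ ρ ≠ σ := by
  constructor
  · rintro h rfl
    exact not_visible_of_mem_span le_rfl (neg_mem (Submodule.subset_span he)) h
  · intro hne x hx s hs hm
    refine hne (hint ρ hρ (hρ.mem_of_smul_add_mem he hm hs ?_))
    simpa using hx

/-- The visible faces are the faces of the facets whose hyperplane separates the point from the
cone. -/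
theorem IsFacetSystem.visible_iff (h : IsFacetSystem τ U) {v : V}
    (hv : v ∈ Submodule.span ℝ (τ : Set V)) {ρ : PointedCone ℝ V} (hρ : ρ ≤ τ) :
    Visible τ v ρ ↔ ∃ u ∈ U, u v < 0 ∧ ρ ≤ kerFace τ u := by
  classical
  constructor
  · intro hV
    by_contra! hcon
    obtain ⟨x, hx, hpos⟩ := h.exists_forall_pos hρ (U.filter fun u => u v < 0)
      (Finset.filter_subset _ _) fun u hu => by
        rw [Finset.mem_filter] at hu
        obtain ⟨x, hx, hxu⟩ := SetLike.not_le_iff_exists.1 (hcon u hu.1 hu.2)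
        exact ⟨x, hx, lt_of_le_of_ne (h.nonneg (hρ hx) hu.1)
          fun h0 => hxu ⟨hρ hx, h0.symm⟩⟩
    obtain ⟨t, ht, hU⟩ := exists_pos_forall_add_smul U x v fun u hu => by
      rcases lt_or_ge (u v) 0 with hlt | hge
      · exact Or.inl (hpos u (Finset.mem_filter.2 ⟨hu, hlt⟩))
      · rcases (h.nonneg (hρ hx) hu).lt_or_eq with h1 | h1
        · exact Or.inl h1
        · exact Or.inr ⟨h1.symm, hge⟩
    refine hV x hx t ht ((h.mem_iff _ ?_).2 (hU t ht.le le_rfl))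
    exact add_mem (Submodule.subset_span (hρ hx)) (Submodule.smul_mem _ _ hv)
  · rintro ⟨u, hu, huv, hle⟩ x hx s hs hm
    have h1 := h.nonneg hm hu
    have h2 : u x = 0 := (hle hx).2
    have h3 := mul_neg_of_pos_of_neg hs huv
    rw [map_add, map_smul, h2, smul_eq_mul] at h1
    linarith

/-- An interior point of a cone which is in general position with respect to a given vector `v`:
the line from `v` to it meets the facet hyperplanes that separate them in distinct points. -/
theorem IsFacetSystem.exists_generic (h : IsFacetSystem τ U) (v : V) :
    ∃ e ∈ τ, (∀ u ∈ U, 0 < u e) ∧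
      ∀ a ∈ U, ∀ b ∈ U, a ≠ b → a v < 0 → b v < 0 → a v * b e ≠ b v * a e := by
  classical
  obtain ⟨e, he, hpos⟩ := h.exists_mem_forall_pos
  let ι := {p : U × U // p.1 ≠ p.2 ∧ p.1.1 v < 0 ∧ p.2.1 v < 0}
  let f : ι → Dual ℝ V := fun p => p.1.1.1 v • p.1.2.1 - p.1.2.1 v • p.1.1.1
  obtain ⟨x, hx, hfx⟩ := Module.Dual.exists_forall_mem_ne_zero_of_forall_exists
    (Submodule.span ℝ (τ : Set V)) f fun p => by
      obtain ⟨z, hz, hzp⟩ := h.exists_mem_kerFace p.1.1.2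
      refine ⟨z, Submodule.subset_span hz.1, ?_⟩
      have h1 : p.1.1.1 z = 0 := hz.2
      have h2 := hzp _ p.1.2.2 (fun h => p.2.1 (Subtype.ext h.symm))
      simp only [f, LinearMap.sub_apply, LinearMap.smul_apply, smul_eq_mul, h1, mul_zero, sub_zero]
      exact mul_ne_zero p.2.2.1.ne h2.ne'
  obtain ⟨t, ht, hU⟩ := exists_pos_forall_add_smul U e x fun u hu => Or.inl (hpos u hu)
  -- all but finitely many points of the segment from `e` to `e + t • x` are in general position
  have hbad : (⋃ p : ι, {s : ℝ | f p (e + s • x) = 0}).Finite := by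
    refine Set.finite_iUnion fun p => Set.Subsingleton.finite ?_
    intro s hs s' hs'
    simp only [Set.mem_ofPred_eq, map_add, map_smul, smul_eq_mul] at hs hs'
    have : (s - s') * f p x = 0 := by linarith
    rcases mul_eq_zero.1 this with h0 | h0
    · linarith
    · exact absurd h0 (hfx p)
  obtain ⟨s, ⟨hs0, hst⟩, hs⟩ := (Set.Ioo_infinite ht).exists_notMem_finite hbad
  refine ⟨e + s • x, ?_, fun u hu => ?_, fun a ha b hb hab hav hbv heq => ?_⟩
  · exact (h.mem_iff _ (add_mem (Submodule.subset_span he) (Submodule.smul_mem _ _ hx))).2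
      (hU s hs0.le hst.le)
  · have h1 := hU t ht.le le_rfl u hu
    have h2 := hpos u hu
    simp only [map_add, map_smul, smul_eq_mul] at h1 ⊢
    have h3 : (t - s) * u e > 0 := mul_pos (by linarith) h2
    have h4 := mul_nonneg hs0.le h1
    have : 0 < t * (u e + s * u x) := by linarith
    exact (mul_pos_iff_of_pos_left ht).1 this
  · refine hs (Set.mem_iUnion.2 ⟨⟨⟨⟨a, ha⟩, ⟨b, hb⟩⟩, fun h => hab (congrArg Subtype.val h),
      hav, hbv⟩, ?_⟩)
    simp only [f, Set.mem_ofPred_eq, LinearMap.sub_apply, LinearMap.smul_apply, smul_eq_mul]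
    linarith

/-- The shelling step: a nonempty visible part of the boundary of `τ` is the union of one facet
and the part visible from some point of the linear span of this facet. -/
theorem exists_shelling_step [FiniteDimensional ℝ V] (hτ : Submodule.FG τ) {v : V}
    (hv : v ∈ Submodule.span ℝ (τ : Set V)) (hvτ : v ∉ τ) :
    ∃ (F : PointedCone ℝ V) (v' : V), F.IsFaceOf τ ∧
      finrank ℝ (Submodule.span ℝ (F : Set V)) + 1 = finrank ℝ (Submodule.span ℝ (τ : Set V)) ∧
      v' ∈ Submodule.span ℝ (F : Set V) ∧
      ∀ ρ : PointedCone ℝ V, ρ.IsFaceOf τ → (Visible τ v ρ ↔ Visible τ v' ρ ∨ ρ ≤ F) := by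
  classical
  obtain ⟨U, h⟩ := exists_isFacetSystem hτ
  obtain ⟨e, he, hpos, hgen⟩ := h.exists_generic v
  have hN : (U.filter fun u => u v < 0).Nonempty := by
    by_contra hN
    rw [Finset.not_nonempty_iff_eq_empty, Finset.filter_eq_empty_iff] at hN
    exact hvτ ((h.mem_iff v hv).2 fun u hu => not_lt.1 (hN hu))
  obtain ⟨a, ha, hmin⟩ := Finset.exists_min_image _ (fun u : Dual ℝ V => -u v / u e) hN
  rw [Finset.mem_filter] at ha
  obtain ⟨haU, hav⟩ := ha
  have hae := hpos a haU
  -- a positive multiple of `v - (a v / a e) • e`, where the line from `v` to `e` meets `a = 0`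
  set v' := a e • v - a v • e with hv'
  have hv's : v' ∈ Submodule.span ℝ (τ : Set V) :=
    sub_mem (Submodule.smul_mem _ _ hv) (Submodule.smul_mem _ _ (Submodule.subset_span he))
  have hav' : a v' = 0 := by simp [hv']; ring
  have hsign : ∀ u ∈ U, u v' < 0 ↔ u v < 0 ∧ u ≠ a := by
    intro u hu
    have hue := hpos u hu
    constructor
    · intro hlt
      refine ⟨?_, by rintro rfl; exact hlt.ne hav'⟩
      by_contra hge
      simp only [hv', map_sub, map_smul, smul_eq_mul] at hlt
      have h1 := mul_nonneg hae.le (not_lt.1 hge)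
      have h2 := mul_pos (neg_pos.2 hav) hue
      linarith
    · rintro ⟨huv, hne⟩
      have h1 := hmin u (Finset.mem_filter.2 ⟨hu, huv⟩)
      rw [div_le_div_iff₀ hae hue] at h1
      have h2 := hgen a haU u hu hne.symm hav huv
      simp only [hv', map_sub, map_smul, smul_eq_mul]
      refine lt_of_le_of_ne (by linarith) fun h3 => h2 (by linarith)
  refine ⟨kerFace τ a, v', h.kerFace_isFaceOf haU, h.finrank_span_kerFace haU, ?_,
    fun ρ hρ => ?_⟩
  · rw [h.span_kerFace haU]
    exact ⟨hv's, hav'⟩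
  · rw [h.visible_iff hv hρ.le, h.visible_iff hv's hρ.le]
    constructor
    · rintro ⟨u, hu, huv, hle⟩
      rcases eq_or_ne u a with rfl | hne
      · exact Or.inr hle
      · exact Or.inl ⟨u, hu, (hsign u hu).2 ⟨huv, hne⟩, hle⟩
    · rintro (⟨u, hu, huv, hle⟩ | hle)
      · exact ⟨u, hu, ((hsign u hu).1 huv).1, hle⟩
      · exact ⟨a, haU, hav, hle⟩

end Cones

/-! ### Facets of full-dimensional cones -/

section Support

variable {V : Type u} [NormedAddCommGroup V] [NormedSpace ℝ V]

/-- The linear span of a cone with an interior point is the whole space. -/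
theorem span_eq_top_of_interior {σ : PointedCone ℝ V} {e : V} (he : e ∈ interior (σ : Set V)) :
    Submodule.span ℝ (σ : Set V) = ⊤ :=
  Submodule.eq_top_of_nonempty_interior' _
    ⟨e, interior_mono Submodule.subset_span he⟩

/-- Facet functionals are positive at interior points. -/
theorem IsFacetSystem.pos_of_interior {σ : PointedCone ℝ V} {U : Finset (Module.Dual ℝ V)}
    (h : IsFacetSystem σ U) {e : V} (he : e ∈ interior (σ : Set V)) {u : Module.Dual ℝ V}
    (hu : u ∈ U) : 0 < u e := by
  refine lt_of_le_of_ne (h.nonneg (interior_subset he) hu) fun h0 => ?_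
  have := face_eq_of_interior (h.kerFace_isFaceOf hu) he ⟨interior_subset he, h0.symm⟩
  obtain ⟨x, hx, hpos⟩ := h.exists_mem_forall_pos
  rw [← this] at hx
  exact (hpos u hu).ne' hx.2

/-- A proper face is contained in a facet. -/
theorem IsFacetSystem.exists_vanishing {σ : PointedCone ℝ V} {U : Finset (Module.Dual ℝ V)}
    (h : IsFacetSystem σ U) {e : V} (he : e ∈ interior (σ : Set V)) {τ : PointedCone ℝ V}
    (hτ : τ.IsFaceOf σ) (hne : τ ≠ σ) : ∃ u ∈ U, ∀ x ∈ τ, u x = 0 := by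
  have hV : Visible σ (-e) τ := (visible_neg_iff hτ (interior_subset he)
    fun ρ hρ hm => face_eq_of_interior hρ he hm).2 hne
  rw [h.visible_iff (by rw [span_eq_top_of_interior he]; trivial) hτ.le] at hV
  obtain ⟨u, hu, -, hle⟩ := hV
  exact ⟨u, hu, fun x hx => (hle hx).2⟩

end Support

/-! ### Projective dimension -/

section ProjectiveDimension

open CategoryTheory

variable {R : Type u} [CommRing R]

/-- The module `N` has projective dimension less than `n`. -/
abbrev PdLT (R : Type u) [CommRing R] (N : Type w) [AddCommGroup N] [Module R N] (n : ℕ) : Prop :=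
  HasProjectiveDimensionLT (ModuleCat.of R N) n

variable {N₁ N₂ N₃ : Type w} [AddCommGroup N₁] [Module R N₁] [AddCommGroup N₂] [Module R N₂]
  [AddCommGroup N₃] [Module R N₃]

theorem PdLT.of_equiv (e : N₁ ≃ₗ[R] N₂) {n : ℕ} (h : PdLT R N₁ n) : PdLT R N₂ n :=
  hasProjectiveDimensionLT_of_iso e.toModuleIso n

theorem PdLT.mono {n m : ℕ} (hnm : n ≤ m) (h : PdLT R N₁ n) : PdLT R N₁ m :=
  hasProjectiveDimensionLT_of_ge (ModuleCat.of R N₁) n m hnm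

theorem PdLT.of_subsingleton [Subsingleton N₁] (n : ℕ) : PdLT R N₁ n := by
  have : HasProjectiveDimensionLT (ModuleCat.of R N₁) 0 :=
    (ModuleCat.isZero_of_subsingleton (ModuleCat.of R N₁)).hasProjectiveDimensionLT_zero
  exact hasProjectiveDimensionLT_of_ge _ 0 n (Nat.zero_le n)

theorem pdLT_one_iff [Small.{w} R] : PdLT R N₁ 1 ↔ Module.Projective R N₁ := by
  rw [IsProjective.iff_projective]
  exact projective_iff_hasProjectiveDimensionLT_one.symm

theorem shortExact_of_linearMap {f : N₁ →ₗ[R] N₂} {g : N₂ →ₗ[R] N₃} (hf : Function.Injective f)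
    (hfg : Function.Exact f g) (hg : Function.Surjective g) :
    (ModuleCat.shortComplexOfCompEqZero f g hfg.linearMap_comp_eq_zero).ShortExact :=
  ModuleCat.shortComplex_shortExact _ hfg hf hg

theorem PdLT.middle {f : N₁ →ₗ[R] N₂} {g : N₂ →ₗ[R] N₃} (hf : Function.Injective f)
    (hfg : Function.Exact f g) (hg : Function.Surjective g) {n : ℕ}
    (h₁ : PdLT R N₁ n) (h₃ : PdLT R N₃ n) : PdLT R N₂ n :=
  (shortExact_of_linearMap hf hfg hg).hasProjectiveDimensionLT_X₂ n h₁ h₃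

theorem PdLT.right {f : N₁ →ₗ[R] N₂} {g : N₂ →ₗ[R] N₃} (hf : Function.Injective f)
    (hfg : Function.Exact f g) (hg : Function.Surjective g) {n : ℕ}
    (h₁ : PdLT R N₁ n) (h₂ : PdLT R N₂ (n + 1)) : PdLT R N₃ (n + 1) :=
  (shortExact_of_linearMap hf hfg hg).hasProjectiveDimensionLT_X₃ n h₁ h₂

theorem PdLT.left {f : N₁ →ₗ[R] N₂} {g : N₂ →ₗ[R] N₃} (hf : Function.Injective f)
    (hfg : Function.Exact f g) (hg : Function.Surjective g) {n : ℕ}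
    (h₂ : PdLT R N₂ n) (h₃ : PdLT R N₃ (n + 1)) : PdLT R N₁ n :=
  (shortExact_of_linearMap hf hfg hg).hasProjectiveDimensionLT_X₁ n h₂ h₃

theorem PdLT.ker {g : N₂ →ₗ[R] N₃} (hg : Function.Surjective g) {n : ℕ}
    (h₂ : PdLT R N₂ n) (h₃ : PdLT R N₃ (n + 1)) : PdLT R (LinearMap.ker g) n :=
  PdLT.left (f := (LinearMap.ker g).subtype) Subtype.val_injective
    (LinearMap.exact_subtype_ker_map g) hg h₂ h₃

theorem finsupp_mapRange_exact {κ N₁ N₂ N₃ : Type*} [AddCommGroup N₁] [Module R N₁]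
    [AddCommGroup N₂] [Module R N₂] [AddCommGroup N₃] [Module R N₃]
    {f : N₁ →ₗ[R] N₂} {g : N₂ →ₗ[R] N₃} (hfg : Function.Exact f g) :
    Function.Exact (Finsupp.mapRange.linearMap (α := κ) f)
      (Finsupp.mapRange.linearMap (α := κ) g) := by
  classical
  intro x
  constructor
  · intro hx
    have h (a : κ) : ∃ y, f y = x a := by
      refine (hfg (x a)).1 ?_
      simpa using DFunLike.congr_fun hx a
    choose y hy using h
    refine ⟨Finsupp.onFinset x.support (fun a => if x a = 0 then 0 else y a)
      (fun a ha => by simp at ha ⊢; exact ha.1), ?_⟩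
    ext a
    by_cases h0 : x a = 0 <;> simp [h0, hy]
  · rintro ⟨y, rfl⟩
    ext a
    simp [hfg.apply_apply_eq_zero]

end ProjectiveDimension

/-! ### Polynomial functions on subspaces -/

section VanishingIdeal

open MvPolynomial

variable {ι : Type}

/-- The restriction of a polynomial to a line. -/
theorem exists_polynomial_eval_line (p : MvPolynomial ι ℝ) (x y : ι → ℝ) :
    ∃ q : Polynomial ℝ, ∀ t : ℝ, q.eval t = eval (x + t • y) p := by
  induction p using MvPolynomial.induction_on with
  | C a => exact ⟨Polynomial.C a, by simp⟩
  | add p q hp hq =>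
    obtain ⟨f, hf⟩ := hp
    obtain ⟨g, hg⟩ := hq
    exact ⟨f + g, fun t => by simp [hf, hg]⟩
  | mul_X p i hp =>
    obtain ⟨f, hf⟩ := hp
    exact ⟨f * (Polynomial.C (x i) + Polynomial.X * Polynomial.C (y i)), fun t => by
      simp only [Polynomial.eval_mul, Polynomial.eval_add, Polynomial.eval_C, Polynomial.eval_X, hf,
        map_mul, eval_X, Pi.add_apply, Pi.smul_apply, smul_eq_mul]⟩

/-- A polynomial which vanishes at infinitely many points of a line vanishes on the line. -/
theorem eval_line_eq_zero (p : MvPolynomial ι ℝ) (x y : ι → ℝ)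
    (h : {t : ℝ | eval (x + t • y) p = 0}.Infinite) (t : ℝ) : eval (x + t • y) p = 0 := by
  obtain ⟨q, hq⟩ := exists_polynomial_eval_line p x y
  have : q = 0 := Polynomial.eq_zero_of_infinite_isRoot q (h.mono fun s hs => by
    rw [Set.mem_ofPred_eq] at hs ⊢
    rw [Polynomial.IsRoot, hq, hs])
  rw [← hq, this, Polynomial.eval_zero]

/-- The linear polynomial of a linear functional. -/
noncomputable def linPoly [Fintype ι] (z : Module.Dual ℝ (ι → ℝ)) : MvPolynomial ι ℝ :=
  ∑ i, z.toFun (Pi.basisFun ℝ ι i) • X i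

theorem eval_linPoly [Fintype ι] (z : Module.Dual ℝ (ι → ℝ)) (x : ι → ℝ) :
    eval x (linPoly z) = z x := by
  conv_rhs => rw [← (Pi.basisFun ℝ ι).sum_repr x, map_sum]
  simp [linPoly, smul_eval, mul_comm]

/-- A polynomial function differs from its pullback along the projection `x ↦ x - z(x) w` by a
multiple of `z`. -/
theorem exists_eval_sub_eq [Fintype ι] (z : Module.Dual ℝ (ι → ℝ)) (w : ι → ℝ)
    (f : MvPolynomial ι ℝ) :
    ∃ g : MvPolynomial ι ℝ, ∀ x, eval x f - eval (x - z x • w) f = z x * eval x g := by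
  induction f using MvPolynomial.induction_on with
  | C a => exact ⟨0, fun x => by simp⟩
  | add p q hp hq =>
    obtain ⟨g, hg⟩ := hp
    obtain ⟨g', hg'⟩ := hq
    refine ⟨g + g', fun x => ?_⟩
    simp only [map_add]
    linear_combination hg x + hg' x
  | mul_X p i hp =>
    obtain ⟨g, hg⟩ := hp
    refine ⟨g * (X i - C (w i) * linPoly z) + p * C (w i), fun x => ?_⟩
    simp only [map_mul, map_add, map_sub, eval_X, eval_C, eval_linPoly, Pi.sub_apply,
      Pi.smul_apply, smul_eq_mul]
    linear_combination (x i - z x * w i) * hg x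

/-- The ideal of polynomials vanishing on a linear subspace. -/
noncomputable abbrev subspaceIdeal (L : Submodule ℝ (ι → ℝ)) : Ideal (MvPolynomial ι ℝ) :=
  vanishingIdeal ℝ (L : Set (ι → ℝ))

theorem mem_subspaceIdeal {L : Submodule ℝ (ι → ℝ)} {p : MvPolynomial ι ℝ} :
    p ∈ subspaceIdeal L ↔ ∀ x ∈ L, eval x p = 0 := by
  rw [mem_vanishingIdeal_iff]
  simp [aeval_eq_eval]

/-- A direct sum of copies of the ring of polynomial functions on a subspace of codimension `c`
has projective dimension at most `c`. -/
theorem pdLT_finsupp_subspaceIdeal [Fintype ι] (κ : Type w) (c : ℕ) (L : Submodule ℝ (ι → ℝ))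
    (hL : Module.finrank ℝ L + c = Fintype.card ι) :
    PdLT (MvPolynomial ι ℝ) (κ →₀ MvPolynomial ι ℝ ⧸ subspaceIdeal L) (c + 1) := by
  induction c generalizing L with
  | zero =>
    have hL' : L = ⊤ := Submodule.eq_top_of_finrank_eq (by simpa using hL)
    have hI : subspaceIdeal L = ⊥ := by
      rw [eq_bot_iff]
      intro p hp
      refine MvPolynomial.funext fun x => ?_
      rw [mem_subspaceIdeal] at hp
      simpa using hp x (by rw [hL']; trivial)
    rw [zero_add, pdLT_one_iff]
    have e := Submodule.quotEquivOfEqBot _ hI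
    exact Module.Projective.of_equiv (Finsupp.mapRange.linearEquiv (α := κ) e.symm)
  | succ c ih =>
    have hne : ∃ v, v ∉ L := by
      by_contra! h
      have : L = ⊤ := eq_top_iff.2 fun v _ => h v
      rw [this, finrank_top, Module.finrank_fintype_fun_eq_card] at hL
      omega
    obtain ⟨v, hv⟩ := hne
    obtain ⟨z, hzv, hzL⟩ := Submodule.exists_le_ker_of_notMem hv
    set w := (z v)⁻¹ • v with hw
    have hzw : z w = 1 := by simp [hw, hzv]
    have hwL : w ∉ L := fun h => by
      have : z w = 0 := hzL h
      rw [hzw] at this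
      exact one_ne_zero this
    set L' := L ⊔ Submodule.span ℝ {w} with hL'
    have hfin : Module.finrank ℝ L' + c = Fintype.card ι := by
      rw [← hL, hL', Submodule.finrank_sup_span_singleton hwL]
      omega
    have hle : subspaceIdeal L' ≤ subspaceIdeal L :=
      vanishingIdeal_anti_mono (show (L : Set (ι → ℝ)) ⊆ L' from le_sup_left (a := L))
    -- the exact sequence `0 → A' → A' → A → 0` of multiplication by `z` and restriction, where `A'`
    -- and `A` are the rings of polynomial functions on `L'` and on `L = L' ∩ ker z`
    let f₀ : (MvPolynomial ι ℝ ⧸ subspaceIdeal L') →ₗ[MvPolynomial ι ℝ]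
      (MvPolynomial ι ℝ ⧸ subspaceIdeal L') := LinearMap.lsmul _ _ (linPoly z)
    let g₀ : (MvPolynomial ι ℝ ⧸ subspaceIdeal L') →ₗ[MvPolynomial ι ℝ]
      (MvPolynomial ι ℝ ⧸ subspaceIdeal L) := Submodule.factor hle
    have hf₀ : Function.Injective f₀ := by
      rw [injective_iff_map_eq_zero]
      intro x hx
      obtain ⟨p, rfl⟩ := Submodule.Quotient.mk_surjective _ x
      have hx' : linPoly z * p ∈ subspaceIdeal L' := (Submodule.Quotient.mk_eq_zero _).1 hx
      rw [Submodule.Quotient.mk_eq_zero, mem_subspaceIdeal]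
      rw [mem_subspaceIdeal] at hx'
      intro x hxL
      have hline : {t : ℝ | eval (x + t • w) p = 0}.Infinite := by
        refine Set.Infinite.mono (s := {-z x}ᶜ) ?_ (Set.finite_singleton _).infinite_compl
        intro t ht
        have h1 := hx' (x + t • w) (add_mem hxL (Submodule.smul_mem _ _
          (Submodule.mem_sup_right (Submodule.mem_span_singleton_self w))))
        rw [map_mul, eval_linPoly, map_add, map_smul, hzw, smul_eq_mul, mul_one] at h1
        rcases mul_eq_zero.1 h1 with h2 | h2
        · exact absurd (by linarith : t = -z x) ht
        · exact h2
      simpa using eval_line_eq_zero p x w hline 0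
    have hfg₀ : Function.Exact f₀ g₀ := by
      intro x
      obtain ⟨p, rfl⟩ := Submodule.Quotient.mk_surjective _ x
      constructor
      · intro hx
        have hp : p ∈ subspaceIdeal L := (Submodule.Quotient.mk_eq_zero _).1 hx
        rw [mem_subspaceIdeal] at hp
        obtain ⟨g, hg⟩ := exists_eval_sub_eq z w p
        refine ⟨Submodule.Quotient.mk g, ?_⟩
        refine (Submodule.Quotient.eq _).2 (mem_subspaceIdeal.2 fun x hx => ?_)
        have hxL : x - z x • w ∈ L := by
          obtain ⟨a, ha, b, hb, rfl⟩ := Submodule.mem_sup.1 hx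
          obtain ⟨t, rfl⟩ := Submodule.mem_span_singleton.1 hb
          have : z a = 0 := hzL ha
          simpa [this, hzw] using ha
        have h1 := hg x
        rw [hp _ hxL] at h1
        change eval x (linPoly z * g - p) = 0
        rw [map_sub, map_mul, eval_linPoly]
        linarith
      · rintro ⟨y, hy⟩
        obtain ⟨q, rfl⟩ := Submodule.Quotient.mk_surjective _ y
        rw [← hy]
        refine (Submodule.Quotient.mk_eq_zero _).2 (mem_subspaceIdeal.2 fun x hx => ?_)
        have : z x = 0 := hzL hx
        change eval x (linPoly z * q) = 0
        rw [map_mul, eval_linPoly, this, zero_mul]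
    have hg₀ : Function.Surjective g₀ := Submodule.factor_surjective hle
    exact PdLT.right (f := Finsupp.mapRange.linearMap (α := κ) f₀)
      (g := Finsupp.mapRange.linearMap (α := κ) g₀)
      (Finsupp.mapRange_injective _ (map_zero _) hf₀) (finsupp_mapRange_exact hfg₀)
      (Finsupp.mapRange_surjective _ (map_zero _) hg₀) (ih L' hfin) ((ih L' hfin).mono (by omega))

/-! ### Linear independence in projective modules -/

/-- In a projective module over a polynomial ring, vectors whose residues at the origin are
linearly independent over the field are linearly independent over the ring. -/
theorem linearIndependent_of_projective {N : Type w} [AddCommGroup N]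
    [Module (MvPolynomial ι ℝ) N] [Module.Projective (MvPolynomial ι ℝ) N] {κ : Type*} (v : κ → N)
    (h : ∀ c : κ →₀ ℝ, (c.sum fun k a => (C a : MvPolynomial ι ℝ) • v k) ∈
      (RingHom.ker (constantCoeff (R := ℝ) (σ := ι)) • ⊤ : Submodule (MvPolynomial ι ℝ) N) →
      c = 0) :
    LinearIndependent (MvPolynomial ι ℝ) v := by
  classical
  obtain ⟨s, hs⟩ := Module.projective_def'.1 ‹Module.Projective (MvPolynomial ι ℝ) N›
  rw [linearIndependent_iff]
  intro b hb
  by_contra hb0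
  have hex : ∃ n, ∃ d : ι →₀ ℕ, d.degree = n ∧ ∃ k, coeff d (b k) ≠ 0 := by
    obtain ⟨k, hk⟩ := Finsupp.ne_iff.1 hb0
    obtain ⟨d, hd⟩ := MvPolynomial.ne_zero_iff.1 hk
    exact ⟨_, d, rfl, k, hd⟩
  obtain ⟨d, hd, k₀, hk₀⟩ := Nat.find_spec hex
  have hmin : ∀ d' : ι →₀ ℕ, d'.degree < d.degree → ∀ k, coeff d' (b k) = 0 := by
    intro d' hd' k
    by_contra hne
    exact Nat.find_min hex (hd ▸ hd') ⟨d', rfl, k, hne⟩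
  -- the coefficients of a monomial of lowest degree give a relation between the residues
  let c : κ →₀ ℝ := b.mapRange (coeff d) (coeff_zero d)
  have hc0 : c ≠ 0 := fun h0 => hk₀ (by simpa [c] using DFunLike.congr_fun h0 k₀)
  refine hc0 (h c ?_)
  -- in the coordinates of a free module containing `N`, the constant terms of the new combination
  -- are the coefficients of this monomial in the given relation, hence zero
  have hcoord : ∀ a : N, s (c.sum fun k a => (C a : MvPolynomial ι ℝ) • v k) a ∈
      RingHom.ker (constantCoeff (R := ℝ) (σ := ι)) := by
    intro a
    have h1 : coeff d (s (Finsupp.linearCombination (MvPolynomial ι ℝ) v b) a) = 0 := by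
      rw [hb]; simp
    rw [Finsupp.linearCombination_apply, Finsupp.sum, map_sum, Finsupp.finsetSum_apply,
      coeff_sum] at h1
    rw [RingHom.mem_ker, Finsupp.sum_mapRange_index (by simp), Finsupp.sum, map_sum,
      Finsupp.finsetSum_apply, map_sum, ← h1]
    refine Finset.sum_congr rfl fun k _ => ?_
    rw [map_smul, map_smul, Finsupp.smul_apply, Finsupp.smul_apply, smul_eq_mul, smul_eq_mul,
      map_mul, constantCoeff_C, coeff_mul, Finset.sum_eq_single (d, 0)]
    · rfl
    · rintro ⟨d₁, d₂⟩ hx hne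
      rw [Finset.HasAntidiagonal.mem_antidiagonal] at hx
      have hd2 : d₂ ≠ 0 := by
        rintro rfl
        exact hne (by rw [← hx]; simp)
      rw [hmin d₁ ?_ k, zero_mul]
      simp only at hx
      rw [← hx, map_add]
      have : d₂.degree ≠ 0 := fun h0 => hd2 ((Finsupp.degree_eq_zero_iff d₂).1 h0)
      omega
    · intro hx
      simp at hx
  have hret : ∀ x : N, Finsupp.linearCombination (MvPolynomial ι ℝ) id (s x) = x :=
    fun x => LinearMap.congr_fun hs x
  rw [← hret (c.sum _), Finsupp.linearCombination_apply]
  exact Submodule.sum_mem _ fun a _ => Submodule.smul_mem_smul (hcoord a) trivial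

end VanishingIdeal

/-! ### Gluing sections -/

section Glue

variable {V : Type u} [NormedAddCommGroup V] [NormedSpace ℝ V] {Φ : Fan V}

namespace GradedSheaf

variable (M : GradedSheaf.{u, w} Φ)

/-- The sheaf axiom for indexed families of opens. -/
theorem existsUnique_glue {κ : Type*} (X : κ → Φ.Opens) {W : Φ.Opens} (hW : W = ⨆ i, X i)
    (s : ∀ i, M.sec (X i))
    (hs : ∀ i j, M.res (inf_le_left : X i ⊓ X j ≤ X i) (s i) =
      M.res (inf_le_right : X i ⊓ X j ≤ X j) (s j)) :
    ∃! t : M.sec W, ∀ i, M.res (hW ▸ le_iSup X i : X i ≤ W) t = s i := by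
  subst hW
  have hch : ∀ U : Set.range X, ∃ i, X i = U.1 := fun U => U.2
  choose ix hix using hch
  -- the sections agree whenever the family has the same open twice
  have key : ∀ i j (h : X i = X j), s i = M.res h.le (s j) := by
    intro i j h
    have h1 : X i ⊓ X j = X i := by rw [← h, inf_idem]
    have h2 := congrArg (M.res h1.ge) (hs i j)
    rw [M.res_trans, M.res_trans, M.res_refl] at h2
    exact h2
  obtain ⟨t, ht, huniq⟩ := M.glue (Set.range X) (fun U => M.res (hix U).ge (s (ix U))) (by
    intro U W
    have h1 : U.1 ⊓ W.1 ≤ X (ix U) ⊓ X (ix W) := by rw [hix, hix]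
    have h2 := congrArg (M.res h1) (hs (ix U) (ix W))
    rw [M.res_trans, M.res_trans] at h2 ⊢
    rw [h2])
  have hle : ∀ i, X i = X (ix ⟨X i, i, rfl⟩) := fun i => (hix ⟨X i, i, rfl⟩).symm
  refine ⟨t, fun i => ?_, fun t' ht' => huniq t' ?_⟩
  · rw [key i _ (hle i)]
    exact ht ⟨X i, i, rfl⟩
  · rintro ⟨_, i, rfl⟩
    have h1 := ht' i
    rw [key i _ (hle i)] at h1
    exact h1

theorem exists_glue_pair {U W : Φ.Opens} (a : M.sec U) (b : M.sec W)
    (h : M.res (inf_le_left : U ⊓ W ≤ U) a = M.res (inf_le_right : U ⊓ W ≤ W) b) :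
    ∃ t : M.sec (U ⊔ W), M.res le_sup_left t = a ∧ M.res le_sup_right t = b := by
  let X : Bool → Φ.Opens := fun i => cond i U W
  let s : ∀ i, M.sec (X i) := fun i => match i with
    | true => a
    | false => b
  obtain ⟨t, ht, -⟩ := M.existsUnique_glue X (W := U ⊔ W) (sup_eq_iSup U W) s (by
    have haux : ∀ {U W : Φ.Opens} (a : M.sec U) (b : M.sec W),
        M.res (inf_le_left : U ⊓ W ≤ U) a = M.res (inf_le_right : U ⊓ W ≤ W) b →
        M.res (inf_le_left : W ⊓ U ≤ W) b = M.res (inf_le_right : W ⊓ U ≤ U) a := by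
      intro U W a b h
      have h2 := congrArg (M.res (inf_comm W U).le) h
      rw [M.res_trans, M.res_trans] at h2
      exact h2.symm
    intro i j
    cases i <;> cases j
    · rfl
    · exact haux a b h
    · exact h
    · rfl)
  exact ⟨t, ht true, ht false⟩

theorem eq_of_res_pair {U W : Φ.Opens} (x y : M.sec (U ⊔ W))
    (hU : M.res (le_sup_left : U ≤ U ⊔ W) x = M.res le_sup_left y)
    (hW : M.res (le_sup_right : W ≤ U ⊔ W) x = M.res le_sup_right y) : x = y := by
  let X : Bool → Φ.Opens := fun i => cond i U W
  obtain ⟨t, -, huniq⟩ := M.existsUnique_glue X (W := U ⊔ W) (sup_eq_iSup U W)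
    (fun i => M.res (by cases i <;> simp [X]) y) (fun i j => by rw [M.res_trans, M.res_trans])
  rw [huniq x ?_, huniq y fun i => rfl]
  intro i
  cases i
  · exact hW
  · exact hU

theorem subsingleton_sec_bot : Subsingleton (M.sec ⊥) := by
  obtain ⟨t, -, huniq⟩ := M.existsUnique_glue (κ := Empty) (fun i => i.elim) (W := ⊥)
    (iSup_of_empty _).symm (fun i => i.elim) fun i => i.elim
  exact ⟨fun x y => (huniq x fun i => i.elim).trans (huniq y fun i => i.elim).symm⟩

variable {M} in
theorem IsBasic.res_surjective (hM : M.IsBasic) {U W : Φ.Opens} (h : U ≤ W) :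
    Function.Surjective (M.res h) := by
  intro x
  obtain ⟨y, rfl⟩ := hM.flabby U x
  exact ⟨M.res le_top y, M.res_trans _ _ _⟩

end GradedSheaf

end Glue

/-! ### Sections as modules over polynomial rings -/

section PolynomialAction

open MvPolynomial

/-- If the pullbacks of the linear functionals along `s` are polynomials in the functions `c i`,
then so are the pullbacks of all polynomial functions. -/
theorem exists_eval_eq_of_mem_polyFun {V : Type u} [AddCommGroup V] [Module ℝ V] {ι : Type}
    {E : Type*} (s : E → V) (c : ι → E → ℝ)
    (h : ∀ l : Module.Dual ℝ V, ∃ p : MvPolynomial ι ℝ, ∀ y, l (s y) = eval (fun i => c i y) p)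
    {f : V → ℝ} (hf : f ∈ polyFun V) :
    ∃ p : MvPolynomial ι ℝ, ∀ y, f (s y) = eval (fun i => c i y) p := by
  induction hf using Algebra.adjoin_induction with
  | mem f hf =>
    obtain ⟨l, rfl⟩ := hf
    exact h l
  | algebraMap r => exact ⟨C r, fun y => by simp⟩
  | add f g _ _ hf hg =>
    obtain ⟨p, hp⟩ := hf
    obtain ⟨q, hq⟩ := hg
    exact ⟨p + q, fun y => by simp [hp, hq]⟩
  | mul f g _ _ hf hg =>
    obtain ⟨p, hp⟩ := hf
    obtain ⟨q, hq⟩ := hg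
    exact ⟨p * q, fun y => by simp [hp, hq]⟩

variable {V : Type u} [NormedAddCommGroup V] [NormedSpace ℝ V] [FiniteDimensional ℝ V]
  {Φ : Fan V} {ι : Type}

/-- The restriction of a linear functional to a subfan. -/
noncomputable def linO (U : Φ.Opens) (h : Module.Dual ℝ V) : O U :=
  ⟨⟨fun x => h x, h.continuous_of_finiteDimensional.comp continuous_subtype_val⟩,
    fun _ _ => ⟨fun x => h x, Algebra.subset_adjoin ⟨h, rfl⟩, fun _ _ => rfl⟩⟩

theorem linO_apply (U : Φ.Opens) (h : Module.Dual ℝ V) (x : Fan.supp U) :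
    (linO U h).1 x = h x := rfl

theorem res_linO {U W : Φ.Opens} (hUW : U ≤ W) (h : Module.Dual ℝ V) :
    O.res hUW (linO W h) = linO U h := rfl

/-- The action of polynomials through a family of linear functionals. -/
noncomputable def polyO (c : ι → Module.Dual ℝ V) (U : Φ.Opens) : MvPolynomial ι ℝ →ₐ[ℝ] O U :=
  aeval fun i => linO U (c i)

theorem polyO_apply (c : ι → Module.Dual ℝ V) (U : Φ.Opens) (p : MvPolynomial ι ℝ)
    (x : Fan.supp U) : (polyO c U p).1 x = eval (fun i => c i x) p := by
  induction p using MvPolynomial.induction_on with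
  | C a => simp [polyO]
  | add p q hp hq => rw [map_add, map_add, ← hp, ← hq]; rfl
  | mul_X p i hp =>
    rw [map_mul, map_mul, ← hp, eval_X]
    simp only [polyO, aeval_X]
    rfl

theorem res_polyO (c : ι → Module.Dual ℝ V) {U W : Φ.Opens} (h : U ≤ W) (p : MvPolynomial ι ℝ) :
    O.res h (polyO c W p) = polyO c U p := by
  rw [← AlgHom.comp_apply]
  congr 1
  refine MvPolynomial.algHom_ext fun i => ?_
  simp [polyO, res_linO]

/-- The sections of a sheaf as a module over a polynomial ring acting through a family of linear
functionals. This is a type synonym recording the family on which the module structure depends. -/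
def PolySec (M : GradedSheaf.{u, w} Φ) (_ : ι → Module.Dual ℝ V) (U : Φ.Opens) : Type w := M.sec U

variable (M : GradedSheaf.{u, w} Φ) (c : ι → Module.Dual ℝ V)

instance (U : Φ.Opens) : AddCommGroup (PolySec M c U) := inferInstanceAs (AddCommGroup (M.sec U))

noncomputable instance (U : Φ.Opens) : Module (O U) (PolySec M c U) :=
  inferInstanceAs (Module (O U) (M.sec U))

noncomputable instance (U : Φ.Opens) : Module (MvPolynomial ι ℝ) (PolySec M c U) :=
  Module.compHom (M.sec U) (polyO c U).toRingHom

theorem polySec_smul_def {U : Φ.Opens} (p : MvPolynomial ι ℝ) (m : PolySec M c U) :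
    p • m = polyO c U p • m := rfl

/-- The restriction maps are linear over the polynomial ring. -/
noncomputable def resL {U W : Φ.Opens} (h : U ≤ W) :
    PolySec M c W →ₗ[MvPolynomial ι ℝ] PolySec M c U where
  toFun := M.res h
  map_add' := map_add (M.res h)
  map_smul' p m := by
    exact (M.res_smul h (polyO c W p) m).trans (by rw [res_polyO]; rfl)

/-- Gluing: the sections over `U ⊔ W` vanishing on `U` are the sections over `W` vanishing on
`U ⊓ W`. Hence the projective dimension of the sections over a union is controlled. -/
theorem pdLT_sup (hM : M.IsBasic) {U W : Φ.Opens} {n : ℕ} (hU : PdLT (MvPolynomial ι ℝ)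
    (PolySec M c U) n) (hW : PdLT (MvPolynomial ι ℝ) (PolySec M c W) n)
    (hUW : PdLT (MvPolynomial ι ℝ) (PolySec M c (U ⊓ W)) (n + 1)) :
    PdLT (MvPolynomial ι ℝ) (PolySec M c (U ⊔ W)) n := by
  have hk := PdLT.ker (g := resL M c (inf_le_right : U ⊓ W ≤ W)) (hM.res_surjective _) hW hUW
  let g := resL M c (le_sup_left : U ≤ U ⊔ W)
  let f₀ : LinearMap.ker g →ₗ[MvPolynomial ι ℝ]
      LinearMap.ker (resL M c (inf_le_right : U ⊓ W ≤ W)) :=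
    (resL M c (le_sup_right : W ≤ U ⊔ W)).restrict fun x hx => by
      have hx' : M.res (le_sup_left : U ≤ U ⊔ W) x = 0 := hx
      exact (M.res_trans _ _ _).trans
        ((M.res_trans (inf_le_left : U ⊓ W ≤ U) le_sup_left x).symm.trans
          ((congrArg (M.res inf_le_left) hx').trans (map_zero _)))
  have hf₀ : Function.Bijective f₀ := by
    constructor
    · rw [injective_iff_map_eq_zero]
      rintro ⟨x, hx⟩ h0
      have hx' : M.res (le_sup_left : U ≤ U ⊔ W) x = 0 := hx
      have h1 : M.res (le_sup_right : W ≤ U ⊔ W) x = 0 := congrArg Subtype.val h0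
      refine Subtype.ext (M.eq_of_res_pair x 0 ?_ ?_)
      · rw [hx', map_zero]
      · rw [h1, map_zero]
    · rintro ⟨y, hy⟩
      obtain ⟨t, ht, ht'⟩ := M.exists_glue_pair (U := U) 0 (y : M.sec W)
        ((map_zero _).trans (show M.res _ y = 0 from hy).symm)
      exact ⟨⟨t, ht⟩, Subtype.ext ht'⟩
  exact PdLT.middle (f := (LinearMap.ker g).subtype) Subtype.val_injective
    (LinearMap.exact_subtype_ker_map g) (hM.res_surjective _)
    (hk.of_equiv (LinearEquiv.ofBijective f₀ hf₀).symm) hU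

/-- The functions on a cone are the polynomials modulo those vanishing on its linear span. -/
theorem ker_polyO_star (F : Φ.cones) :
    RingHom.ker (polyO c (Φ.star F)) = subspaceIdeal
      ((Submodule.span ℝ (F.1 : Set V)).map (LinearMap.pi c)) := by
  ext p
  rw [RingHom.mem_ker, mem_subspaceIdeal]
  constructor
  · intro hp
    have h0 : ∀ x ∈ F.1, eval (LinearMap.pi c x) p = 0 := by
      intro x hx
      have := congrArg (fun f : O (Φ.star F) => f.1 ⟨x, F, LowerSet.mem_Iic_iff.2 le_rfl, hx⟩) hp
      simp only [polyO_apply] at this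
      exact this
    rintro _ ⟨x, hx, rfl⟩
    obtain ⟨a, ha, b, hb, rfl⟩ := exists_sub_of_mem_span hx
    have hline := eval_line_eq_zero p (LinearMap.pi c a) (LinearMap.pi c b)
      ((Set.Ici_infinite (0 : ℝ)).mono fun t ht => by
        have h1 := h0 _ (add_mem ha (smul_mem_cone (Set.mem_Ici.1 ht) hb))
        rw [map_add, map_smul] at h1
        exact h1) (-1)
    rw [map_sub, sub_eq_add_neg, ← neg_one_smul ℝ (LinearMap.pi c b)]
    exact hline
  · intro hp
    refine Subtype.ext (ContinuousMap.ext fun x => ?_)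
    rw [polyO_apply]
    obtain ⟨ρ, hρ, hx⟩ := x.2
    exact hp _ ⟨x, Submodule.subset_span (LowerSet.mem_Iic_iff.1 hρ hx), rfl⟩

/-- If the functionals separate the points of the linear span of a cone, then every function on
the cone is a polynomial in them. -/
theorem polyO_star_surjective [Fintype ι] (F : Φ.cones)
    (hF : ∀ x ∈ Submodule.span ℝ (F.1 : Set V), (∀ i, c i x = 0) → x = 0) :
    Function.Surjective (polyO c (Φ.star F)) := by
  intro f
  obtain ⟨q, hq, hfq⟩ := f.2 F (LowerSet.mem_Iic_iff.2 le_rfl)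
  set L := Submodule.span ℝ (F.1 : Set V)
  obtain ⟨s, hs⟩ := ((LinearMap.pi c).domRestrict L).exists_leftInverse_of_injective (by
    rw [LinearMap.ker_eq_bot']
    rintro ⟨x, hx⟩ h0
    exact Subtype.ext (hF x hx fun i => congrFun h0 i))
  obtain ⟨p, hp⟩ := exists_eval_eq_of_mem_polyFun (ι := ι) (fun y : L => (y : V))
    (fun i y => c i y) (fun l => by
      refine ⟨linPoly (l ∘ₗ L.subtype ∘ₗ s), fun y => ?_⟩
      change l y = eval (LinearMap.pi c y.1) _
      rw [eval_linPoly]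
      exact congrArg (fun z : L => l z) (LinearMap.congr_fun hs y).symm) hq
  refine ⟨p, Subtype.ext (ContinuousMap.ext fun x => ?_)⟩
  obtain ⟨ρ, hρ, hx⟩ := x.2
  have hxF : x.1 ∈ F.1 := LowerSet.mem_Iic_iff.1 hρ hx
  rw [polyO_apply, hfq x hxF]
  exact (hp ⟨x, Submodule.subset_span hxF⟩).symm

/-- The sections over a cone `F` on whose span the functionals separate the points have projective
dimension at most `N - dim F`, where `N` is the number of the functionals. -/
theorem pdLT_star [Fintype ι] (hM : M.IsBasic) (F : Φ.cones)
    (hF : ∀ x ∈ Submodule.span ℝ (F.1 : Set V), (∀ i, c i x = 0) → x = 0) (m : ℕ)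
    (hm : Module.finrank ℝ (Submodule.span ℝ (F.1 : Set V)) + m = Fintype.card ι) :
    PdLT (MvPolynomial ι ℝ) (PolySec M c (Φ.star F)) (m + 1) := by
  obtain ⟨E, ⟨hli, -⟩, hspan⟩ := hM.free F
  let b : Module.Basis E (O (Φ.star F)) (M.sec (Φ.star F)) :=
    Module.Basis.mk hli (by rw [Subtype.range_coe, hspan])
  set L := (Submodule.span ℝ (F.1 : Set V)).map (LinearMap.pi c)
  have hL : Module.finrank ℝ L + m = Fintype.card ι := by
    have hinj : Function.Injective
        ((LinearMap.pi c).domRestrict (Submodule.span ℝ (F.1 : Set V))) := by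
      rw [← LinearMap.ker_eq_bot, LinearMap.ker_eq_bot']
      rintro ⟨x, hx⟩ h0
      exact Subtype.ext (hF x hx fun i => congrFun h0 i)
    rw [← hm, ← LinearMap.finrank_range_of_inj hinj, LinearMap.range_domRestrict]
  have h := pdLT_finsupp_subspaceIdeal E m L hL
  let ψ : (MvPolynomial ι ℝ ⧸ subspaceIdeal L) ≃+* O (Φ.star F) :=
    (Ideal.quotEquivOfEq (ker_polyO_star c F).symm).trans
      (RingHom.quotientKerEquivOfSurjective (f := (polyO c (Φ.star F)).toRingHom)
        (polyO_star_surjective c F hF))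
  have hψ : ∀ p, ψ (Ideal.Quotient.mk _ p) = polyO c (Φ.star F) p := fun p => rfl
  let e : PolySec M c (Φ.star F) ≃ₗ[MvPolynomial ι ℝ] (E →₀ MvPolynomial ι ℝ ⧸ subspaceIdeal L) :=
    { (b.repr.toAddEquiv.trans (Finsupp.mapRange.addEquiv ψ.symm.toAddEquiv)) with
      map_smul' := fun p x => by
        ext a
        change ψ.symm (b.repr (polyO c (Φ.star F) p • x) a) =
          p • ψ.symm (b.repr x a)
        rw [show b.repr (polyO c (Φ.star F) p • x) = polyO c (Φ.star F) p • b.repr x from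
          map_smul b.repr _ _, Finsupp.smul_apply, smul_eq_mul, map_mul, ← hψ, ψ.symm_apply_apply]
        rfl }
  exact h.of_equiv e.symm

end PolynomialAction

/-! ### Projectivity of the sections over the boundary -/

section Shelling

open MvPolynomial

variable {V : Type u} [NormedAddCommGroup V] [NormedSpace ℝ V] {Φ : Fan V}

/-- The subfan of the faces of `τ` which are visible from `v`. -/
def visibleFan (τ : Φ.cones) (v : V) : Φ.Opens where
  carrier := {ρ | ρ ≤ τ ∧ Visible τ.1 v ρ.1}
  lower' _ _ h hρ := ⟨h.trans hρ.1, hρ.2.anti h⟩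

variable [FiniteDimensional ℝ V] {ι : Type} [Fintype ι] (M : GradedSheaf.{u, w} Φ)
  (c : ι → Module.Dual ℝ V)

/-- Let `N` linear functionals separate the points of the span of each proper face of `τ`. Then
the sections over the part of the boundary of `τ` visible from a point have projective dimension
at most `N + 1 - dim τ`. In particular, they are projective if `dim τ = N + 1`. -/
theorem pdLT_visibleFan (hM : M.IsBasic) (r : ℕ) : ∀ (τ : Φ.cones) (v : V) (m : ℕ),
    v ∈ Submodule.span ℝ (τ.1 : Set V) →
    Module.finrank ℝ (Submodule.span ℝ (τ.1 : Set V)) = r → r + m = Fintype.card ι + 1 →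
    (∀ ρ < τ, ∀ x ∈ Submodule.span ℝ (ρ.1 : Set V), (∀ i, c i x = 0) → x = 0) →
    PdLT (MvPolynomial ι ℝ) (PolySec M c (visibleFan τ v)) (m + 1) := by
  induction r with
  | zero =>
    intro τ v m hv hr _ _
    have h0 : v = 0 := by
      rw [Submodule.finrank_eq_zero] at hr
      rwa [hr, Submodule.mem_bot] at hv
    have hbot : visibleFan τ v = ⊥ := by
      refine eq_bot_iff.2 fun ρ hρ => ?_
      exact (not_visible_of_mem (by rw [h0]; exact zero_mem _) hρ.2).elim
    rw [hbot]
    have : Subsingleton (PolySec M c (⊥ : Φ.Opens)) := M.subsingleton_sec_bot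
    exact PdLT.of_subsingleton _
  | succ r ih =>
    intro τ v m hv hr hm hsep
    have : Finite Φ.cones := Φ.finite
    induction hn : Set.ncard (visibleFan τ v : Set Φ.cones) using Nat.strong_induction_on
      generalizing v with
    | _ n ihn =>
    by_cases hvτ : v ∈ τ.1
    · have hbot : visibleFan τ v = ⊥ :=
        eq_bot_iff.2 fun ρ hρ => (not_visible_of_mem hvτ hρ.2).elim
      rw [hbot]
      have : Subsingleton (PolySec M c (⊥ : Φ.Opens)) := M.subsingleton_sec_bot
      exact PdLT.of_subsingleton _
    -- the visible part is the union of a facet `F` and a smaller visible part, which meet in a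
    -- visible part of the boundary of `F`
    obtain ⟨F₀, v', hF, hfin, hv', hstep⟩ := exists_shelling_step (Φ.polyhedral _ τ.2) hv hvτ
    let F : Φ.cones := ⟨F₀, Φ.face_mem _ τ.2 _ hF⟩
    have hFτ : F < τ := by
      refine lt_of_le_of_ne hF.le fun h => ?_
      have : F₀ = τ.1 := congrArg Subtype.val h
      rw [this] at hfin
      omega
    have hv'τ : v' ∈ Submodule.span ℝ (τ.1 : Set V) := Submodule.span_mono hF.le hv'
    have hsup : visibleFan τ v = visibleFan τ v' ⊔ Φ.star F := by
      ext ρ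
      change (ρ ≤ τ ∧ _) ↔ (ρ ≤ τ ∧ _) ∨ ρ ≤ F
      constructor
      · rintro ⟨hρ, hV⟩
        exact ((hstep _ ((Φ.isFaceOf_iff_le ρ τ).2 hρ)).1 hV).imp (fun h => ⟨hρ, h⟩) id
      · intro h
        have hρ : ρ ≤ τ := h.elim And.left fun h => h.trans hFτ.le
        exact ⟨hρ, (hstep _ ((Φ.isFaceOf_iff_le ρ τ).2 hρ)).2 (h.imp And.right id)⟩
    have hinf : visibleFan τ v' ⊓ Φ.star F = visibleFan F v' := by
      ext ρ
      change ((ρ ≤ τ ∧ _) ∧ ρ ≤ F) ↔ (ρ ≤ F ∧ _)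
      constructor
      · rintro ⟨⟨-, hV⟩, hρ⟩
        exact ⟨hρ, (visible_iff_of_mem_span hF hv' hρ).1 hV⟩
      · rintro ⟨hρ, hV⟩
        exact ⟨⟨hρ.trans hFτ.le, (visible_iff_of_mem_span hF hv' hρ).2 hV⟩, hρ⟩
    have hcard : Set.ncard (visibleFan τ v' : Set Φ.cones) < n := by
      rw [← hn]
      refine Set.ncard_lt_ncard ⟨fun ρ hρ => ?_, fun hle => ?_⟩ (Set.toFinite _)
      · rw [hsup]; exact Or.inl hρ
      · have hFm : F ∈ visibleFan τ v := by rw [hsup]; exact Or.inr (le_refl F)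
        exact not_visible_of_mem_span hF.le hv' (hle hFm).2
    have hFr : Module.finrank ℝ (Submodule.span ℝ (F.1 : Set V)) = r := by
      change Module.finrank ℝ (Submodule.span ℝ (F₀ : Set V)) = r
      omega
    rw [hsup]
    refine pdLT_sup M c hM (ihn _ hcard v' hv'τ rfl)
      (pdLT_star M c hM F (hsep F hFτ) m (by omega)) ?_
    rw [hinf]
    exact ih F v' (m + 1) hv' hFr (by omega) fun ρ hρ => hsep ρ (hρ.trans hFτ)

end Shelling

section Boundary

variable {V : Type u} [NormedAddCommGroup V] [NormedSpace ℝ V] [FiniteDimensional ℝ V]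
  {σ : PointedCone ℝ V} {hσ : Submodule.FG σ} {hs : (σ : ConvexCone ℝ V).Salient}

/-- The projection along an interior vector is injective on the span of a proper face. -/
theorem eq_zero_of_proj_eq_zero {V : Type u} [NormedAddCommGroup V] [NormedSpace ℝ V]
    {σ τ : PointedCone ℝ V} (hτ : τ.IsFaceOf σ) (hne : τ ≠ σ) {e : V}
    (he : e ∈ interior (σ : Set V)) {l : Module.Dual ℝ V} (hle : l e = 1) {x : V}
    (hx : x ∈ Submodule.span ℝ (τ : Set V)) (h0 : proj l e hle x = 0) : x = 0 := by
  obtain ⟨a, ha, b, hb, rfl⟩ := exists_sub_of_mem_span hx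
  rw [map_sub, sub_eq_zero] at h0
  rw [proj_injOn hτ hne hτ hne he hle ha hb h0, sub_self]

/-- The sections over the boundary of a full-dimensional cone form a projective module over the
ring of polynomials on the hyperplane `ℓ = 0`, which act through the projection along an interior
vector. -/
theorem projective_bdry {e : V} (he : e ∈ interior (σ : Set V)) {l : Module.Dual ℝ V}
    (hle : l e = 1) (M : GradedSheaf.{u, w} (coneFan σ hσ hs)) (hM : M.IsBasic) {ι : Type}
    [Fintype ι] (b : Module.Basis ι ℝ (LinearMap.ker l)) :
    Module.Projective (MvPolynomial ι ℝ) (PolySec M (fun i => b.coord i ∘ₗ proj l e hle)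
      ((coneFan σ hσ hs).bdry (coneFan.self σ hσ hs))) := by
  have hint : ∀ τ : PointedCone ℝ V, τ.IsFaceOf σ → e ∈ τ → τ = σ :=
    fun τ hτ h => face_eq_of_interior hτ he h
  have hvis : (coneFan σ hσ hs).bdry (coneFan.self σ hσ hs) =
      visibleFan (coneFan.self σ hσ hs) (-e) := by
    ext ρ
    change ρ < _ ↔ ρ ≤ _ ∧ Visible σ (-e) ρ.1
    rw [visible_neg_iff ρ.2 (interior_subset he) hint, lt_iff_le_and_ne]
    exact and_congr_right fun _ => not_congr Subtype.ext_iff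
  have htop : Submodule.span ℝ (σ : Set V) = ⊤ := span_eq_top_of_interior he
  have hl : l ≠ 0 := fun h => by simp [h] at hle
  rw [← pdLT_one_iff, hvis]
  refine pdLT_visibleFan M _ hM _ (coneFan.self σ hσ hs) (-e) 0 ?_ rfl ?_ ?_
  · change -e ∈ Submodule.span ℝ (σ : Set V)
    rw [htop]; trivial
  · change Module.finrank ℝ (Submodule.span ℝ (σ : Set V)) + 0 = _
    rw [htop, finrank_top, ← Module.finrank_eq_card_basis b,
      Module.Dual.finrank_ker_add_one_of_ne_zero hl, add_zero]
  · intro ρ hρ x hx h0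
    exact eq_zero_of_proj_eq_zero ρ.2 (fun h => hρ.ne (Subtype.ext h)) he hle hx
      (b.ext_elem fun i => by simpa using h0 i)

end Boundary

/-! ### Transport of sheaves along linear maps -/

section Compose

variable {V E : Type u} [AddCommGroup V] [Module ℝ V] [AddCommGroup E] [Module ℝ E]

theorem polyFun_comp (p : V →ₗ[ℝ] E) {f : E → ℝ}
    (hf : f ∈ polyFun E) : f ∘ p ∈ polyFun V := by
  induction hf using Algebra.adjoin_induction with
  | mem f hf =>
    obtain ⟨l, rfl⟩ := hf
    exact Algebra.subset_adjoin ⟨l ∘ₗ p, rfl⟩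
  | algebraMap r => exact (polyFun V).algebraMap_mem r
  | add f g _ _ hf hg => exact add_mem hf hg
  | mul f g _ _ hf hg => exact mul_mem hf hg

theorem homPolyFun_comp (p : V →ₗ[ℝ] E) {f : E → ℝ} {k : ℕ}
    (hf : f ∈ homPolyFun E k) : f ∘ p ∈ homPolyFun V k := by
  induction hf using Submodule.span_induction with
  | mem f hf =>
    obtain ⟨l, rfl⟩ := hf
    exact Submodule.subset_span ⟨fun i => l i ∘ₗ p, rfl⟩
  | zero => exact zero_mem _
  | add f g _ _ hf hg => exact add_mem hf hg
  | smul r f _ hf => exact Submodule.smul_mem _ r hf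

end Compose

section SemilinearTransport

variable {R R' N N' : Type*} [CommRing R] [CommRing R'] [AddCommGroup N] [AddCommGroup N']
  [Module R N] [Module R' N'] (ψ : R ≃+* R') (j : N ≃+ N')

theorem symm_semilinear (hj : ∀ r m, j (r • m) = ψ r • j m) (r : R') (m : N') :
    j.symm (r • m) = ψ.symm r • j.symm m := by
  rw [j.symm_apply_eq, hj, ψ.apply_symm_apply, j.apply_symm_apply]

theorem linearIndependent_image_of_semilinear (hj : ∀ r m, j (r • m) = ψ r • j m) (B : Set N)
    (h : LinearIndependent R (fun b : B => (b : N))) :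
    LinearIndependent R' (fun b : j '' B => (b : N')) := by
  have h1 : LinearIndependent R' (j ∘ fun b : B => (b : N)) :=
    h.map_of_injective_injective ψ.symm j.toAddMonoidHom (fun r hr => by simpa using hr)
      (fun m hm => by simpa using hm) fun r m => by simp [hj]
  have h2 := h1.linearIndepOn_id
  have h3 : Set.range (j ∘ fun b : B => (b : N)) = j '' B := by
    rw [Set.range_comp, Subtype.range_coe]
  rw [h3] at h2
  exact h2

theorem map_mem_span_image_of_semilinear (hj : ∀ r m, j (r • m) = ψ r • j m) (B : Set N) {m : N}
    (hm : m ∈ Submodule.span R B) : j m ∈ Submodule.span R' (j '' B) := by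
  induction hm using Submodule.span_induction with
  | mem x hx => exact Submodule.subset_span ⟨x, hx, rfl⟩
  | zero => rw [map_zero]; exact zero_mem _
  | add x y _ _ hx hy => rw [map_add]; exact add_mem hx hy
  | smul r x _ hx => rw [hj]; exact Submodule.smul_mem _ _ hx

theorem span_image_eq_top_of_semilinear (hj : ∀ r m, j (r • m) = ψ r • j m) (B : Set N) :
    Submodule.span R' (j '' B) = ⊤ ↔ Submodule.span R B = ⊤ := by
  constructor
  · intro h
    refine eq_top_iff.2 fun m _ => ?_
    have h1 : j m ∈ Submodule.span R' (j '' B) := by rw [h]; trivial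
    have h2 := map_mem_span_image_of_semilinear ψ.symm j.symm (symm_semilinear ψ j hj) _ h1
    rw [j.symm_apply_apply, Set.image_image] at h2
    simpa using h2
  · intro h
    refine eq_top_iff.2 fun m _ => ?_
    have h1 : j.symm m ∈ Submodule.span R B := by rw [h]; trivial
    simpa using map_mem_span_image_of_semilinear ψ j hj _ h1

end SemilinearTransport

section Transport

variable {V W : Type u} [NormedAddCommGroup V] [NormedSpace ℝ V]
  [NormedAddCommGroup W] [NormedSpace ℝ W]

/-- An isomorphism from a subfan of `Φ` onto a fan `Ψ` which is induced by a linear map. -/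
structure SubfanIso (Φ : Fan V) (Ψ : Fan W) (p : V →ₗ[ℝ] W) where
  /-- The cone of `Φ` which is mapped onto a given cone of `Ψ`. -/
  lift : Ψ.cones ↪o Φ.cones
  /-- The image of the lift is a subfan. -/
  exists_lift_eq : ∀ a b, b ≤ lift a → ∃ c, lift c = b
  map_lift : ∀ a, (lift a).1.map p = a.1
  /-- The linear map is injective on the span of each cone, so that the two cones have the same
  functions. -/
  eq_zero : ∀ a, ∀ x ∈ Submodule.span ℝ ((lift a).1 : Set V), p x = 0 → x = 0

namespace SubfanIso

variable {Φ : Fan V} {Ψ : Fan W} {p : V →ₗ[ℝ] W} (T : SubfanIso Φ Ψ p)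

/-- The subfan of `Φ` which corresponds to a subfan of `Ψ`. -/
def pull (U : Ψ.Opens) : Φ.Opens where
  carrier := T.lift '' U
  lower' := by
    rintro _ b hb ⟨a, ha, rfl⟩
    obtain ⟨c, rfl⟩ := T.exists_lift_eq a b hb
    exact ⟨c, U.lower (T.lift.le_iff_le.1 hb) ha, rfl⟩

theorem pull_mono {U U' : Ψ.Opens} (h : U ≤ U') : T.pull U ≤ T.pull U' :=
  Set.image_mono h

theorem pull_star (a : Ψ.cones) : T.pull (Ψ.star a) = Φ.star (T.lift a) := by
  ext b
  constructor
  · rintro ⟨c, hc, rfl⟩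
    exact T.lift.le_iff_le.2 hc
  · intro hb
    obtain ⟨c, rfl⟩ := T.exists_lift_eq a b hb
    exact ⟨c, T.lift.le_iff_le.1 hb, rfl⟩

theorem pull_bdry (a : Ψ.cones) : T.pull (Ψ.bdry a) = Φ.bdry (T.lift a) := by
  ext b
  constructor
  · rintro ⟨c, hc, rfl⟩
    exact T.lift.lt_iff_lt.2 hc
  · intro hb
    obtain ⟨c, rfl⟩ := T.exists_lift_eq a b (LowerSet.mem_Iio_iff.1 hb).le
    exact ⟨c, T.lift.lt_iff_lt.1 hb, rfl⟩

theorem pull_inf (U U' : Ψ.Opens) : T.pull (U ⊓ U') = T.pull U ⊓ T.pull U' := by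
  ext b
  exact Set.ext_iff.1 (Set.image_inter T.lift.injective) b

theorem pull_sSup (𝒰 : Set Ψ.Opens) : T.pull (sSup 𝒰) = ⨆ U : 𝒰, T.pull U.1 := by
  ext b
  rw [LowerSet.coe_iSup, Set.mem_iUnion]
  constructor
  · rintro ⟨a, ha, rfl⟩
    obtain ⟨U, hU, haU⟩ := LowerSet.mem_sSup_iff.1 ha
    exact ⟨⟨U, hU⟩, a, haU, rfl⟩
  · rintro ⟨U, a, ha, rfl⟩
    exact ⟨a, LowerSet.mem_sSup_iff.2 ⟨U.1, U.2, ha⟩, rfl⟩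

theorem lift_zeroCone : T.lift Ψ.zeroCone = Φ.zeroCone := by
  refine Subtype.ext ?_
  refine eq_bot_iff.2 fun x hx => ?_
  have h1 : p x ∈ Ψ.zeroCone.1 := by
    rw [← T.map_lift]
    exact PointedCone.mem_map.2 ⟨x, hx, rfl⟩
  exact T.eq_zero Ψ.zeroCone x (Submodule.subset_span hx) h1

theorem map_mem_supp {U : Ψ.Opens} {x : V} (hx : x ∈ Fan.supp (T.pull U)) : p x ∈ Fan.supp U := by
  obtain ⟨_, ⟨a, ha, rfl⟩, hx⟩ := hx
  exact ⟨a, ha, by rw [← T.map_lift]; exact PointedCone.mem_map.2 ⟨_, hx, rfl⟩⟩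

variable [FiniteDimensional ℝ V]

/-- The linear map on the supports of corresponding subfans. -/
def suppMap (U : Ψ.Opens) : C(Fan.supp (T.pull U), Fan.supp U) where
  toFun x := ⟨p x, T.map_mem_supp x.2⟩
  continuous_toFun := (p.continuous_of_finiteDimensional.comp continuous_subtype_val).subtype_mk _

theorem suppMap_surjective (U : Ψ.Opens) : Function.Surjective (T.suppMap U) := by
  rintro ⟨y, a, ha, hy⟩
  rw [← T.map_lift] at hy
  obtain ⟨x, hx, rfl⟩ := PointedCone.mem_map.1 hy
  exact ⟨⟨x, T.lift a, ⟨a, ha, rfl⟩, hx⟩, rfl⟩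

/-- The pullback of piecewise polynomial functions. -/
noncomputable def pullO (U : Ψ.Opens) : O U →ₐ[ℝ] O (T.pull U) :=
  AlgHom.codRestrict ((ContinuousMap.compRightAlgHom ℝ ℝ (T.suppMap U)).comp (O U).val)
    (O (T.pull U)) (by
      rintro f _ ⟨a, ha, rfl⟩
      obtain ⟨q, hq, hfq⟩ := f.2 a ha
      refine ⟨q ∘ p, polyFun_comp p hq, fun x hx => hfq (T.suppMap U x) ?_⟩
      rw [← T.map_lift]
      exact PointedCone.mem_map.2 ⟨_, hx, rfl⟩)

theorem pullO_apply (U : Ψ.Opens) (f : O U) (x : Fan.supp (T.pull U)) :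
    (T.pullO U f).1 x = f.1 (T.suppMap U x) := rfl

theorem pullO_injective (U : Ψ.Opens) : Function.Injective (T.pullO U) := by
  intro f g h
  refine Subtype.ext (ContinuousMap.ext fun y => ?_)
  obtain ⟨x, rfl⟩ := T.suppMap_surjective U y
  rw [← pullO_apply, h, pullO_apply]

theorem pullO_isHomogeneous {U : Ψ.Opens} {f : O U} {k : ℕ} (hf : O.IsHomogeneous f k) :
    O.IsHomogeneous (T.pullO U f) k := by
  rintro _ ⟨a, ha, rfl⟩
  obtain ⟨q, hq, hfq⟩ := hf a ha
  refine ⟨q ∘ p, homPolyFun_comp p hq, fun x hx => hfq (T.suppMap U x) ?_⟩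
  rw [← T.map_lift]
  exact PointedCone.mem_map.2 ⟨_, hx, rfl⟩

/-- The sheaf on `Ψ` which corresponds to the restriction of a sheaf on `Φ`. -/
noncomputable def pullSheaf (M : GradedSheaf.{u, w} Φ) : GradedSheaf.{u, w} Ψ where
  sec U := M.sec (T.pull U)
  module U := Module.compHom (M.sec (T.pull U)) (T.pullO U).toRingHom
  res h := M.res (T.pull_mono h)
  res_refl U m := M.res_refl _ m
  res_trans h h' m := M.res_trans _ _ m
  res_smul h f m := M.res_smul (T.pull_mono h) (T.pullO _ f) m
  glue 𝒰 s hs := by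
    refine M.existsUnique_glue (fun U : 𝒰 => T.pull U.1) (T.pull_sSup 𝒰) s fun U U' => ?_
    have h1 := congrArg (M.res (T.pull_inf U.1 U'.1).ge) (hs U U')
    rw [M.res_trans, M.res_trans] at h1
    exact h1
  deg U k := M.deg (T.pull U) k
  isInternal U := M.isInternal _
  smul_mem_deg f m hf hm := M.smul_mem_deg (T.pullO _ f) m (T.pullO_isHomogeneous hf) hm
  res_mem_deg h _ m hm := M.res_mem_deg (T.pull_mono h) m hm

variable (M : GradedSheaf.{u, w} Φ)

/-- The identification of the sections of corresponding sheaves over corresponding subfans. -/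
noncomputable def secEquiv {U : Ψ.Opens} {X : Φ.Opens} (h : T.pull U = X) :
    (T.pullSheaf M).sec U ≃+ M.sec X where
  toFun m := M.res h.ge m
  invFun m := M.res h.le m
  left_inv _ := (M.res_trans _ _ _).trans (M.res_refl _ _)
  right_inv _ := (M.res_trans _ _ _).trans (M.res_refl _ _)
  map_add' := map_add (M.res h.ge)

theorem secEquiv_smul {U : Ψ.Opens} {X : Φ.Opens} (h : T.pull U = X) (f : O U)
    (m : (T.pullSheaf M).sec U) :
    T.secEquiv M h (f • m) = O.res h.ge (T.pullO U f) • T.secEquiv M h m :=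
  M.res_smul h.ge (T.pullO U f) m

theorem secEquiv_mem_deg {U : Ψ.Opens} {X : Φ.Opens} (h : T.pull U = X)
    (m : (T.pullSheaf M).sec U) (k : ℕ) :
    T.secEquiv M h m ∈ M.deg X k ↔ m ∈ (T.pullSheaf M).deg U k := by
  constructor
  · intro hm
    have h1 := M.res_mem_deg h.le _ hm
    exact (congrArg (· ∈ M.deg (T.pull U) k) ((T.secEquiv M h).symm_apply_apply m)).mp h1
  · exact fun hm => M.res_mem_deg h.ge m hm

theorem res_secEquiv {U U' : Ψ.Opens} {X X' : Φ.Opens} (h : T.pull U = X) (h' : T.pull U' = X')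
    (hU : U ≤ U') (hX : X ≤ X') (m : (T.pullSheaf M).sec U') :
    M.res hX (T.secEquiv M h' m) = T.secEquiv M h ((T.pullSheaf M).res hU m) :=
  (M.res_trans _ _ _).trans (M.res_trans _ _ _).symm

variable [FiniteDimensional ℝ W]

/-- Corresponding cones have the same ring of functions. -/
theorem pullO_star_bijective (a : Ψ.cones) : Function.Bijective fun f : O (Ψ.star a) =>
    O.res (T.pull_star a).ge (T.pullO (Ψ.star a) f) := by
  constructor
  · intro f g h
    apply T.pullO_injective
    refine Subtype.ext (ContinuousMap.ext fun x => ?_)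
    have hx : x.1 ∈ Fan.supp (Φ.star (T.lift a)) := Fan.supp_mono (T.pull_star a).le x.2
    exact DFunLike.congr_fun (congrArg Subtype.val h) ⟨x.1, hx⟩
  · intro f
    let b := Module.finBasis ℝ W
    obtain ⟨q, rfl⟩ := polyO_star_surjective (fun i => b.coord i ∘ₗ p) (T.lift a)
      (fun x hx h0 => T.eq_zero a x hx (b.ext_elem fun i => by simpa using h0 i)) f
    refine ⟨polyO (fun i => b.coord i) (Ψ.star a) q, Subtype.ext (ContinuousMap.ext fun x => ?_)⟩
    rw [polyO_apply]
    exact polyO_apply (fun i => b.coord i) (Ψ.star a) q _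

/-- The isomorphism between the rings of functions on corresponding cones. -/
noncomputable def starEquiv (a : Ψ.cones) : O (Ψ.star a) ≃+* O (Φ.star (T.lift a)) :=
  RingEquiv.ofBijective ((O.res (T.pull_star a).ge).comp (T.pullO (Ψ.star a)))
    (T.pullO_star_bijective a)

theorem isHomogeneousBasisOfSpan_image (a : Ψ.cones)
    (B : Set ((T.pullSheaf M).sec (Ψ.star a))) :
    (T.pullSheaf M).IsHomogeneousBasisOfSpan (Ψ.star a) B ↔
      M.IsHomogeneousBasisOfSpan (Φ.star (T.lift a)) (T.secEquiv M (T.pull_star a) '' B) := by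
  have hj := T.secEquiv_smul M (T.pull_star a)
  refine and_congr ⟨fun h => ?_, fun h => ?_⟩ ⟨?_, fun h b hb => ?_⟩
  · exact linearIndependent_image_of_semilinear (T.starEquiv a) _ hj B h
  · have h1 := linearIndependent_image_of_semilinear (T.starEquiv a).symm
      (T.secEquiv M (T.pull_star a)).symm (symm_semilinear (T.starEquiv a) _ hj) _ h
    have h2 : (T.secEquiv M (T.pull_star a)).symm '' (T.secEquiv M (T.pull_star a) '' B) = B := by
      rw [Set.image_image]; simp
    rwa [h2] at h1
  · rintro h _ ⟨b, hb, rfl⟩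
    obtain ⟨k, hk⟩ := h b hb
    exact ⟨k, (T.secEquiv_mem_deg M _ _ _).2 hk⟩
  · obtain ⟨k, hk⟩ := h _ ⟨b, hb, rfl⟩
    exact ⟨k, (T.secEquiv_mem_deg M _ _ _).1 hk⟩

/-- The properties of a basic sheaf only involve cones and their boundaries, on which the functions
and the sections of the two sheaves correspond. -/
theorem isBasic_pullSheaf (hM : M.IsBasic) : (T.pullSheaf M).IsBasic where
  normalization := by
    have h0 := T.pull_star Ψ.zeroCone
    have hn : Nonempty (M.sec (Φ.star (T.lift Ψ.zeroCone)) ≃ₗ[O (Φ.star (T.lift Ψ.zeroCone))]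
        O (Φ.star (T.lift Ψ.zeroCone))) ∧ M.deg (Φ.star (T.lift Ψ.zeroCone)) 0 = ⊤ := by
      rw [lift_zeroCone]; exact hM.normalization
    obtain ⟨⟨f⟩, hdeg⟩ := hn
    refine ⟨⟨{ ((T.secEquiv M h0).trans f.toAddEquiv).trans
      (T.starEquiv Ψ.zeroCone).symm.toAddEquiv with map_smul' := fun r m => ?_ }⟩, ?_⟩
    · have h1 : f (T.secEquiv M h0 (r • m)) =
          T.starEquiv Ψ.zeroCone r * f (T.secEquiv M h0 m) :=
        (congrArg f (T.secEquiv_smul M h0 r m)).trans (f.map_smul _ _)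
      change (T.starEquiv Ψ.zeroCone).symm (f (T.secEquiv M h0 (r • m))) =
        r * (T.starEquiv Ψ.zeroCone).symm (f (T.secEquiv M h0 m))
      rw [h1, map_mul, RingEquiv.symm_apply_apply]
    · refine eq_top_iff.2 fun m _ => ?_
      rw [← T.secEquiv_mem_deg M h0, hdeg]
      trivial
  free a := by
    obtain ⟨B, hB, hspan⟩ := hM.free (T.lift a)
    have hB' : B = T.secEquiv M (T.pull_star a) ''
        ((T.secEquiv M (T.pull_star a)).symm '' B) := by
      rw [Set.image_image]; simp
    refine ⟨(T.secEquiv M (T.pull_star a)).symm '' B, ?_, ?_⟩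
    · rw [isHomogeneousBasisOfSpan_image, ← hB']
      exact hB
    · rw [← span_image_eq_top_of_semilinear (T.starEquiv a) (T.secEquiv M (T.pull_star a))
        (T.secEquiv_smul M (T.pull_star a)), ← hB']
      exact hspan
  flabby U := hM.res_surjective _
  minimal a ha B hB hsurj := by
    rw [← span_image_eq_top_of_semilinear (T.starEquiv a) (T.secEquiv M (T.pull_star a))
        (T.secEquiv_smul M (T.pull_star a))]
    refine hM.minimal (T.lift a) (fun h => ha (T.lift.injective (h.trans T.lift_zeroCone.symm)))
      _ ((T.isHomogeneousBasisOfSpan_image M a B).1 hB) fun t => ?_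
    obtain ⟨m, hm, hmt⟩ := hsurj ((T.secEquiv M (T.pull_bdry a)).symm t)
    refine ⟨T.secEquiv M (T.pull_star a) m, map_mem_span_image_of_semilinear (T.starEquiv a)
      (T.secEquiv M (T.pull_star a)) (T.secEquiv_smul M (T.pull_star a)) _ hm, ?_⟩
    rw [T.res_secEquiv M (T.pull_bdry a) (T.pull_star a) (Ψ.bdry_le_star a), hmt,
      AddEquiv.apply_symm_apply]

end SubfanIso

end Transport

/-! ### The projected boundary fan and its support function -/

section BoundaryIso

variable {V : Type u} [NormedAddCommGroup V] [NormedSpace ℝ V]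
  {σ : PointedCone ℝ V} {hσ : Submodule.FG σ} {hs : (σ : ConvexCone ℝ V).Salient}
  {e : V} (he : e ∈ interior (σ : Set V)) {l : Module.Dual ℝ V} (hle : l e = 1)

theorem le_of_map_proj_le {τ τ' : PointedCone ℝ V} (he : e ∈ interior (σ : Set V))
    (hτ : τ.IsFaceOf σ) (hne : τ ≠ σ) (hτ' : τ'.IsFaceOf σ)
    (hne' : τ' ≠ σ) (h : τ.map (proj l e hle) ≤ τ'.map (proj l e hle)) : τ ≤ τ' := by
  intro x hx
  obtain ⟨y, hy, hyx⟩ := PointedCone.mem_map.1 (h (PointedCone.mem_map.2 ⟨x, hx, rfl⟩))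
  rwa [← proj_injOn hτ' hne' hτ hne he hle hy hx hyx]

/-- The projection identifies the boundary of a full-dimensional cone with the projected boundary
fan. -/
noncomputable def boundaryIso : SubfanIso (coneFan σ hσ hs) (boundaryFan σ hσ hs l e he hle)
    (proj l e hle) :=
  have hch : ∀ a : (boundaryFan σ hσ hs l e he hle).cones, ∃ τ : PointedCone ℝ V,
      (τ.IsFaceOf σ ∧ τ ≠ σ) ∧ τ.map (proj l e hle) = a.1 := fun a => a.2
  { lift := OrderEmbedding.ofMapLEIff
      (fun a => (⟨(hch a).choose, (hch a).choose_spec.1.1⟩ : (coneFan σ hσ hs).cones))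
      fun a b => by
        constructor
        · intro h
          change a.1 ≤ b.1
          rw [← (hch a).choose_spec.2, ← (hch b).choose_spec.2]
          exact Submodule.map_mono h
        · intro h
          have h' : a.1 ≤ b.1 := h
          rw [← (hch a).choose_spec.2, ← (hch b).choose_spec.2] at h'
          exact le_of_map_proj_le hle he (hch a).choose_spec.1.1 (hch a).choose_spec.1.2
            (hch b).choose_spec.1.1 (hch b).choose_spec.1.2 h'
    exists_lift_eq := by
      intro a b hb
      have hbne : b.1 ≠ σ := by
        intro h
        refine (hch a).choose_spec.1.2 (le_antisymm (hch a).choose_spec.1.1.le ?_)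
        exact h.symm.le.trans hb
      let c : (boundaryFan σ hσ hs l e he hle).cones :=
        ⟨b.1.map (proj l e hle), b.1, ⟨b.2, hbne⟩, rfl⟩
      refine ⟨c, Subtype.ext ?_⟩
      change (hch c).choose = b.1
      have h2 := (hch c).choose_spec
      exact le_antisymm (le_of_map_proj_le hle he h2.1.1 h2.1.2 b.2 hbne h2.2.le)
        (le_of_map_proj_le hle he b.2 hbne h2.1.1 h2.1.2 h2.2.ge)
    map_lift := fun a => (hch a).choose_spec.2
    eq_zero := fun a _ hx h0 => eq_zero_of_proj_eq_zero (hch a).choose_spec.1.1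
      (hch a).choose_spec.1.2 he hle hx h0 }

theorem boundaryIso_lift_ne (a : (boundaryFan σ hσ hs l e he hle).cones) :
    ((boundaryIso he hle).lift a).1 ≠ σ :=
  (Exists.choose_spec (p := fun τ : PointedCone ℝ V =>
    (τ.IsFaceOf σ ∧ τ ≠ σ) ∧ τ.map (proj l e hle) = a.1) a.2).1.2

theorem boundaryIso_pull_top : (boundaryIso (hσ := hσ) (hs := hs) he hle).pull ⊤ =
    (coneFan σ hσ hs).bdry (coneFan.self σ hσ hs) := by
  ext b
  constructor
  · rintro ⟨a, -, rfl⟩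
    change _ < coneFan.self σ hσ hs
    refine lt_of_le_of_ne ((boundaryIso he hle).lift a).2.le fun h => ?_
    exact boundaryIso_lift_ne he hle a (Subtype.ext_iff.1 h)
  · intro hb
    have hne : b.1 ≠ σ := fun h => (LowerSet.mem_Iio_iff.1 hb).ne (Subtype.ext h)
    let c : (boundaryFan σ hσ hs l e he hle).cones :=
      ⟨b.1.map (proj l e hle), b.1, ⟨b.2, hne⟩, rfl⟩
    refine ⟨c, trivial, Subtype.ext ?_⟩
    have h1 := (boundaryIso (hσ := hσ) (hs := hs) he hle).map_lift c
    have h2 := ((boundaryIso (hσ := hσ) (hs := hs) he hle).lift c).2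
    have h3 := boundaryIso_lift_ne (hσ := hσ) (hs := hs) he hle c
    exact le_antisymm (le_of_map_proj_le hle he h2 h3 b.2 hne h1.le)
      (le_of_map_proj_le hle he b.2 hne h2 h3 h1.ge)

/-- The support function of the link polytope, as a piecewise linear function on the projected
boundary fan: it is the pullback of the functional `ℓ` on the boundary of the cone. -/
theorem exists_supportFunction [FiniteDimensional ℝ V] :
    ∃ S : O (⊤ : (boundaryFan σ hσ hs l e he hle).Opens),
      (∀ x : Fan.supp (⊤ : (boundaryFan σ hσ hs l e he hle).Opens),
        IsGreatest ((fun a : Module.Dual ℝ (LinearMap.ker l) => a x) '' linkPolytope σ l e hle)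
          (S.1 x)) ∧
      (boundaryIso he hle).pullO ⊤ S = linO _ l := by
  obtain ⟨U, hU⟩ := exists_isFacetSystem hσ
  have hpos : ∀ u ∈ U, 0 < u e := fun u hu => hU.pos_of_interior he hu
  have hne : U.Nonempty := by
    have hbot : (⊥ : PointedCone ℝ V) ≠ σ := by
      rintro rfl
      have he' : e ∈ (⊥ : PointedCone ℝ V) := interior_subset he
      rw [Submodule.mem_bot] at he'
      simp [he'] at hle
    obtain ⟨u, hu, -⟩ := hU.exists_vanishing he (bot_isFaceOf hs) hbot
    exact ⟨u, hu⟩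
  -- the vertices of the polytope come from the facets of the cone
  let a : Module.Dual ℝ V → Module.Dual ℝ (LinearMap.ker l) :=
    fun u => -(u e)⁻¹ • u ∘ₗ (LinearMap.ker l).subtype
  have ha : ∀ u ∈ U, ∀ v, a u (proj l e hle v) = l v - (u e)⁻¹ * u v := by
    intro u hu v
    have := (hpos u hu).ne'
    simp only [a, LinearMap.smul_apply, LinearMap.comp_apply, Submodule.subtype_apply, proj_apply,
      map_sub, map_smul, smul_eq_mul]
    field_simp
    ring
  have hvan : ∀ b : (boundaryFan σ hσ hs l e he hle).cones, ∃ u ∈ U,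
      ∀ v ∈ ((boundaryIso he hle).lift b).1, u v = 0 := fun b =>
    hU.exists_vanishing he ((boundaryIso he hle).lift b).2 (boundaryIso_lift_ne he hle b)
  -- the support function, which is attained at the vertices
  let S₀ : LinearMap.ker l → ℝ := fun x => U.sup' hne fun u => a u x
  have hS₀c : Continuous S₀ := Continuous.finset_sup'_apply hne fun u _ =>
    (a u).continuous_of_finiteDimensional
  have hS₀ : ∀ (b : (boundaryFan σ hσ hs l e he hle).cones),
      ∀ v ∈ ((boundaryIso he hle).lift b).1, S₀ (proj l e hle v) = l v := by
    intro b v hv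
    have hvσ : v ∈ σ := ((boundaryIso he hle).lift b).2.le hv
    apply le_antisymm
    · refine Finset.sup'_le _ _ fun u hu => ?_
      rw [ha u hu]
      have := mul_nonneg (inv_nonneg.2 (hpos u hu).le) (hU.nonneg hvσ hu)
      linarith
    · obtain ⟨u, hu, hu0⟩ := hvan b
      refine le_trans ?_ (Finset.le_sup' _ hu)
      rw [ha u hu, hu0 v hv]
      simp
  have hlift : ∀ (b : (boundaryFan σ hσ hs l e he hle).cones), ∀ x ∈ b.1,
      ∃ v ∈ ((boundaryIso he hle).lift b).1, proj l e hle v = x := by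
    intro b x hx
    rw [← (boundaryIso he hle).map_lift] at hx
    exact PointedCone.mem_map.1 hx
  refine ⟨⟨⟨fun x => S₀ x, hS₀c.comp continuous_subtype_val⟩, fun b _ => ?_⟩, fun x => ?_, ?_⟩
  · obtain ⟨u, hu, hu0⟩ := hvan b
    refine ⟨fun x => a u x, Algebra.subset_adjoin ⟨a u, rfl⟩, fun x hx => ?_⟩
    obtain ⟨v, hv, hvx⟩ := hlift b x hx
    change S₀ x.1 = a u x.1
    rw [← hvx, hS₀ b v hv, ha u hu, hu0 v hv]
    simp
  · obtain ⟨b, -, hx⟩ := x.2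
    obtain ⟨v, hv, hvx⟩ := hlift b x hx
    have hSx : S₀ x.1 = l v := by rw [← hvx, hS₀ b v hv]
    change IsGreatest _ (S₀ x.1)
    rw [hSx]
    constructor
    · obtain ⟨u, hu, hu0⟩ := hvan b
      refine ⟨a u, fun w hw => ?_, ?_⟩
      · rw [ha u hu]
        have := mul_nonneg (inv_nonneg.2 (hpos u hu).le) (hU.nonneg hw hu)
        linarith
      · change a u x.1 = l v
        rw [← hvx, ha u hu, hu0 v hv]
        simp
    · rintro _ ⟨a', ha', rfl⟩
      change a' x.1 ≤ l v
      rw [← hvx]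
      exact ha' v (((boundaryIso he hle).lift b).2.le hv)
  · refine Subtype.ext (ContinuousMap.ext fun x => ?_)
    obtain ⟨_, ⟨b, -, rfl⟩, hx⟩ := x.2
    exact hS₀ b _ hx

end BoundaryIso

/-! ### Hard Lefschetz in terms of sections -/

section Augmentation

open MvPolynomial

variable {ι : Type}

theorem mem_span_X_of_mem_ker_constantCoeff {p : MvPolynomial ι ℝ}
    (hp : p ∈ RingHom.ker (constantCoeff (R := ℝ) (σ := ι))) :
    p ∈ Ideal.span (Set.range (X : ι → MvPolynomial ι ℝ)) := by
  rw [← Set.image_univ, mem_ideal_span_X_image]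
  intro d hd
  by_contra! h
  have : d = 0 := Finsupp.ext fun i => h i (Set.mem_univ i)
  rw [this, mem_support_iff] at hd
  exact hd hp

variable {V : Type u} [NormedAddCommGroup V] [NormedSpace ℝ V] [FiniteDimensional ℝ V]
  {Φ : Fan V} (M : GradedSheaf.{u, w} Φ)

/-- The submodule of the sections generated by the products with polynomials without constant
term. -/
noncomputable abbrev augSec (c : ι → Module.Dual ℝ V) (U : Φ.Opens) :
    Submodule (MvPolynomial ι ℝ) (PolySec M c U) :=
  RingHom.ker (constantCoeff (R := ℝ) (σ := ι)) • ⊤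

theorem linO_smul_mem_augSec [Fintype ι] (c : ι → Module.Dual ℝ V) {U : Φ.Opens}
    {h : Module.Dual ℝ V} (hc : h ∈ Submodule.span ℝ (Set.range c)) (m : PolySec M c U) :
    linO U h • m ∈ augSec M c U := by
  obtain ⟨a, rfl⟩ := (Submodule.mem_span_range_iff_exists_fun ℝ).1 hc
  have h1 : linO U (∑ i, a i • c i) = polyO c U (∑ i, C (a i) * X i) := by
    refine Subtype.ext (ContinuousMap.ext fun x => ?_)
    rw [polyO_apply, linO_apply]
    simp
  rw [h1, ← polySec_smul_def]
  refine Submodule.smul_mem_smul ?_ trivial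
  rw [RingHom.mem_ker]
  simp

/-- In coordinates, the products of the global sections with the ideal generated by the linear
functions. -/
theorem mem_oplus_smul_iff [Fintype ι] (b : Module.Basis ι ℝ V)
    (m : PolySec M b.coord (⊤ : Φ.Opens)) :
    m ∈ (Oplus Φ • ⊤ : Submodule (O (⊤ : Φ.Opens)) (PolySec M b.coord ⊤)) ↔
      m ∈ augSec M b.coord ⊤ := by
  constructor
  · intro hm
    refine Submodule.smul_induction_on (p := fun m => m ∈ augSec M b.coord ⊤) hm
      (fun r hr n _ => ?_) fun x y hx hy => add_mem hx hy
    revert n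
    refine Submodule.span_induction (p := fun r _ => ∀ n : PolySec M b.coord (⊤ : Φ.Opens),
      n ∈ (⊤ : Submodule (O (⊤ : Φ.Opens)) (PolySec M b.coord ⊤)) → r • n ∈ augSec M b.coord ⊤)
      ?_ ?_ ?_ ?_ hr
    · rintro f ⟨h, hf⟩ n -
      have : f = linO ⊤ h := Subtype.ext (ContinuousMap.ext hf)
      rw [this]
      refine linO_smul_mem_augSec M b.coord ?_ n
      have h1 := b.sum_dual_apply_smul_coord h
      rw [← h1]
      exact Submodule.sum_mem _ fun i _ => Submodule.smul_mem _ _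
        (Submodule.subset_span ⟨i, rfl⟩)
    · intro n _
      rw [zero_smul]
      exact zero_mem _
    · intro x y _ _ hx hy n hn
      rw [add_smul]
      exact add_mem (hx n hn) (hy n hn)
    · intro a x _ hx n _
      rw [smul_eq_mul, mul_comm, mul_smul]
      exact hx (a • n) trivial
  · intro hm
    refine Submodule.smul_induction_on
      (p := fun m => m ∈ (Oplus Φ • ⊤ : Submodule (O (⊤ : Φ.Opens)) (PolySec M b.coord ⊤))) hm
      (fun r hr n _ => ?_) fun x y hx hy => add_mem hx hy
    rw [polySec_smul_def]
    refine Submodule.smul_mem_smul ?_ trivial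
    have h1 := Ideal.mem_map_of_mem (polyO (Φ := Φ) b.coord ⊤).toRingHom
      (mem_span_X_of_mem_ker_constantCoeff hr)
    rw [Ideal.map_span] at h1
    refine Ideal.span_mono ?_ h1
    rintro _ ⟨_, ⟨i, rfl⟩, rfl⟩
    refine ⟨b.coord i, fun x => ?_⟩
    change (polyO b.coord ⊤ (X i)).1 x = _
    rw [polyO_apply, eval_X]

/-- Hard Lefschetz in terms of the global sections, without passing to the quotient. -/
theorem HardLefschetz.of_polySec [Fintype ι] (b : Module.Basis ι ℝ V)
    {Δ : Set (Module.Dual ℝ V)} (hHL : HardLefschetz.{u, w} Φ Δ) {S : O (⊤ : Φ.Opens)}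
    (hS : ∀ x : Fan.supp (⊤ : Φ.Opens),
      IsGreatest ((fun a : Module.Dual ℝ V => a x) '' Δ) (S.1 x)) (hM : M.IsBasic) {k : ℕ}
    (hk : 2 * k < Fintype.card ι)
    {m : PolySec M b.coord (⊤ : Φ.Opens)} (hm : m ∈ M.deg ⊤ k)
    (hSm : S ^ (Fintype.card ι - 2 * k) • m ∈ augSec M b.coord ⊤) : m ∈ augSec M b.coord ⊤ := by
  have hn : Module.finrank ℝ V = Fintype.card ι := Module.finrank_eq_card_basis b
  have h := hHL S hS M hM k (by rwa [hn])
  rw [hn] at h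
  set r := Fintype.card ι - 2 * k
  -- the quotient map, seen from the module over the polynomial ring
  let q : PolySec M b.coord (⊤ : Φ.Opens) →ₗ[O (⊤ : Φ.Opens)] M.Coh := Submodule.mkQ _
  have hq : ∀ m, q m = 0 ↔ m ∈ augSec M b.coord ⊤ := by
    intro m
    rw [← mem_oplus_smul_iff]
    exact Submodule.Quotient.mk_eq_zero _
  rw [← hq] at hSm ⊢
  refine h.injOn ⟨m, hm, rfl⟩ (zero_mem _) ?_
  change S ^ r • q m = S ^ r • 0
  rw [smul_zero, ← map_smul, hSm]

end Augmentation

section HardLefschetzBoundary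

open MvPolynomial

variable {V : Type u} [NormedAddCommGroup V] [NormedSpace ℝ V] [FiniteDimensional ℝ V]
  {σ : PointedCone ℝ V} {hσ : Submodule.FG σ} {hs : (σ : ConvexCone ℝ V).Salient}
  {e : V} (he : e ∈ interior (σ : Set V)) {l : Module.Dual ℝ V} (hle : l e = 1)
  (M : GradedSheaf.{u, w} (coneFan σ hσ hs)) {ι : Type} (b : Module.Basis ι ℝ (LinearMap.ker l))

/-- The boundary of a cone, as a subfan of the fan of its faces. -/
abbrev coneBdry (σ : PointedCone ℝ V) (hσ : Submodule.FG σ)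
    (hs : (σ : ConvexCone ℝ V).Salient) : (coneFan σ hσ hs).Opens :=
  (coneFan σ hσ hs).bdry (coneFan.self σ hσ hs)

/-- The sections over the boundary of a cone, as a module over the polynomials on the hyperplane
`ℓ = 0`. -/
abbrev BdrySec : Type w :=
  PolySec M (fun i => b.coord i ∘ₗ proj l e hle) (coneBdry σ hσ hs)

/-- The submodule of the sections over the boundary of a cone generated by the products with
polynomials on the hyperplane `ℓ = 0` without constant term. -/
noncomputable abbrev bdryAug : Submodule (MvPolynomial ι ℝ) (BdrySec hle M b) :=
  augSec M (fun i => b.coord i ∘ₗ proj l e hle) (coneBdry σ hσ hs)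

/-- The sections over the projected boundary fan and over the boundary of the cone agree, as
modules over the polynomials on the hyperplane. -/
noncomputable def bdrySecEquiv : PolySec ((boundaryIso he hle).pullSheaf M) b.coord ⊤
    ≃ₗ[MvPolynomial ι ℝ] BdrySec hle M b :=
  { (boundaryIso he hle).secEquiv M (boundaryIso_pull_top he hle) with
    map_smul' := fun p m => by
      refine ((boundaryIso he hle).secEquiv_smul M (boundaryIso_pull_top he hle)
        (polyO b.coord ⊤ p) m).trans ?_
      have h1 : O.res (boundaryIso_pull_top he hle).ge
          ((boundaryIso (hσ := hσ) (hs := hs) he hle).pullO ⊤ (polyO b.coord ⊤ p)) =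
          polyO (fun i => b.coord i ∘ₗ proj l e hle) _ p := by
        refine Subtype.ext (ContinuousMap.ext fun x => ?_)
        rw [polyO_apply]
        exact polyO_apply b.coord ⊤ p _
      rw [h1]
      rfl }

theorem bdrySecEquiv_mem_augSec (m : PolySec ((boundaryIso he hle).pullSheaf M) b.coord ⊤) :
    bdrySecEquiv he hle M b m ∈ bdryAug hle M b ↔
      m ∈ augSec ((boundaryIso he hle).pullSheaf M) b.coord ⊤ := by
  have h1 : (augSec ((boundaryIso he hle).pullSheaf M) b.coord ⊤).map
      (bdrySecEquiv he hle M b).toLinearMap = bdryAug hle M b := by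
    rw [augSec, Submodule.map_smul'', Submodule.map_top, LinearEquiv.range]
  rw [← h1]
  constructor
  · rintro ⟨x, hx, hxm⟩
    rwa [← (bdrySecEquiv he hle M b).injective hxm]
  · exact fun h => ⟨m, h, rfl⟩

/-- Hard Lefschetz for the projected boundary fan in terms of the sections over the boundary of
the cone, on which the support function acts as the functional `ℓ`. -/
theorem hardLefschetz_bdry [Fintype ι]
    (hHL : HardLefschetz.{u, w} (boundaryFan σ hσ hs l e he hle) (linkPolytope σ l e hle))
    (hM : M.IsBasic) {k : ℕ} (hk : 2 * k < Fintype.card ι)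
    {m : BdrySec hle M b} (hm : m ∈ M.deg _ k)
    (hSm : linO (coneBdry σ hσ hs) l ^ (Fintype.card ι - 2 * k) • m ∈ bdryAug hle M b) :
    m ∈ bdryAug hle M b := by
  obtain ⟨S, hS, hSl⟩ := exists_supportFunction (hσ := hσ) (hs := hs) he hle
  set r := Fintype.card ι - 2 * k
  let j := bdrySecEquiv he hle M b
  have hjdeg : ∀ m q, j m ∈ M.deg _ q ↔ m ∈ ((boundaryIso he hle).pullSheaf M).deg ⊤ q :=
    fun m q => (boundaryIso he hle).secEquiv_mem_deg M (boundaryIso_pull_top he hle) m q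
  have hjS : ∀ m, j (S ^ r • m) = linO (coneBdry σ hσ hs) l ^ r • j m := by
    intro m
    refine ((boundaryIso he hle).secEquiv_smul M (boundaryIso_pull_top he hle) (S ^ r) m).trans ?_
    rw [map_pow, map_pow, hSl]
    rfl
  have hjaug : ∀ m, j m ∈ bdryAug hle M b ↔
      m ∈ augSec ((boundaryIso he hle).pullSheaf M) b.coord ⊤ :=
    bdrySecEquiv_mem_augSec he hle M b
  obtain ⟨m, rfl⟩ := j.surjective m
  rw [hjaug]
  rw [← hjS, hjaug] at hSm
  exact HardLefschetz.of_polySec _ b hHL hS ((boundaryIso he hle).isBasic_pullSheaf M hM) hk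
    ((hjdeg m k).1 hm) hSm

end HardLefschetzBoundary

/-! ### Homogeneous components -/

section Components

variable {V : Type u} [NormedAddCommGroup V] [NormedSpace ℝ V] {Φ : Fan V}

namespace GradedSheaf

variable (M : GradedSheaf.{u, w} Φ)

/-- The homogeneous component of degree `q` of a section. -/
noncomputable def comp (U : Φ.Opens) (q : ℕ) : M.sec U →+ M.sec U :=
  (M.deg U q).subtype.comp ((DFinsupp.evalAddMonoidHom q).comp
    (AddEquiv.ofBijective (DirectSum.coeAddMonoidHom (M.deg U))
      (M.isInternal U)).symm.toAddMonoidHom)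

theorem comp_mem (U : Φ.Opens) (q : ℕ) (m : M.sec U) : M.comp U q m ∈ M.deg U q :=
  SetLike.coe_mem _

theorem coeEquiv_symm_of_mem {U : Φ.Opens} {q : ℕ} {m : M.sec U} (hm : m ∈ M.deg U q) :
    (AddEquiv.ofBijective (DirectSum.coeAddMonoidHom (M.deg U)) (M.isInternal U)).symm m =
      DirectSum.of (fun i => M.deg U i) q ⟨m, hm⟩ := by
  rw [AddEquiv.symm_apply_eq]
  exact (DirectSum.coeAddMonoidHom_of (M.deg U) q ⟨m, hm⟩).symm

theorem comp_of_mem {U : Φ.Opens} {q : ℕ} {m : M.sec U} (hm : m ∈ M.deg U q) :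
    M.comp U q m = m := by
  change (((AddEquiv.ofBijective (DirectSum.coeAddMonoidHom (M.deg U)) (M.isInternal U)).symm m) q :
    M.sec U) = m
  rw [coeEquiv_symm_of_mem M hm, DirectSum.of_eq_same]

theorem comp_of_mem_of_ne {U : Φ.Opens} {q q' : ℕ} {m : M.sec U} (hm : m ∈ M.deg U q)
    (h : q ≠ q') : M.comp U q' m = 0 := by
  change (((AddEquiv.ofBijective (DirectSum.coeAddMonoidHom (M.deg U))
    (M.isInternal U)).symm m) q' : M.sec U) = 0
  rw [coeEquiv_symm_of_mem M hm, DirectSum.of_eq_of_ne _ _ _ h.symm]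
  rfl

theorem homogeneous_induction {U : Φ.Opens} {P : M.sec U → Prop}
    (hom : ∀ q, ∀ m ∈ M.deg U q, P m) (add : ∀ m m', P m → P m' → P (m + m')) (m : M.sec U) :
    P m := by
  obtain ⟨x, rfl⟩ := (M.isInternal U).2 m
  induction x using DirectSum.induction_on with
  | zero => rw [map_zero]; exact hom 0 0 (zero_mem _)
  | of i x => rw [DirectSum.coeAddMonoidHom_of]; exact hom i _ x.2
  | add x y hx hy => rw [map_add]; exact add _ _ hx hy

theorem res_comp {U W : Φ.Opens} (h : U ≤ W) (q : ℕ) (m : M.sec W) :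
    M.res h (M.comp W q m) = M.comp U q (M.res h m) := by
  induction m using M.homogeneous_induction with
  | hom i m hm =>
    rcases eq_or_ne i q with rfl | hne
    · rw [comp_of_mem M hm, comp_of_mem M (M.res_mem_deg h m hm)]
    · rw [comp_of_mem_of_ne M hm hne, comp_of_mem_of_ne M (M.res_mem_deg h m hm) hne, map_zero]
  | add m m' hm hm' => simp only [map_add, hm, hm']

theorem comp_smul {U : Φ.Opens} {f : O U} {i : ℕ} (hf : O.IsHomogeneous f i) (q : ℕ)
    (m : M.sec U) : M.comp U (i + q) (f • m) = f • M.comp U q m := by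
  induction m using M.homogeneous_induction with
  | hom j m hm =>
    have h := M.smul_mem_deg f m hf hm
    rcases eq_or_ne j q with rfl | hne
    · rw [comp_of_mem M hm, comp_of_mem M h]
    · rw [comp_of_mem_of_ne M hm hne, comp_of_mem_of_ne M h (by omega), smul_zero]
  | add m m' hm hm' => simp only [smul_add, map_add, hm, hm']

theorem comp_smul_of_lt {U : Φ.Opens} {f : O U} {i : ℕ} (hf : O.IsHomogeneous f i) {q : ℕ}
    (hq : q < i) (m : M.sec U) : M.comp U q (f • m) = 0 := by
  induction m using M.homogeneous_induction with
  | hom j m hm => exact comp_of_mem_of_ne M (M.smul_mem_deg f m hf hm) (by omega)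
  | add m m' hm hm' => simp only [smul_add, map_add, hm, hm', add_zero]

end GradedSheaf

end Components

section HomogeneousPolynomials

variable {V : Type u} [AddCommGroup V] [Module ℝ V]

theorem homPolyFun_mul {i j : ℕ} {f g : V → ℝ} (hf : f ∈ homPolyFun V i)
    (hg : g ∈ homPolyFun V j) : f * g ∈ homPolyFun V (i + j) := by
  induction hf using Submodule.span_induction with
  | zero => rw [zero_mul]; exact zero_mem _
  | add f f' _ _ hf hf' => rw [add_mul]; exact add_mem hf hf'
  | smul r f _ hf => rw [smul_mul_assoc]; exact Submodule.smul_mem _ r hf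
  | mem f hf =>
    obtain ⟨a, rfl⟩ := hf
    induction hg using Submodule.span_induction with
    | zero => rw [mul_zero]; exact zero_mem _
    | add g g' _ _ hg hg' => rw [mul_add]; exact add_mem hg hg'
    | smul r g _ hg => rw [mul_smul_comm]; exact Submodule.smul_mem _ r hg
    | mem g hg =>
      obtain ⟨b, rfl⟩ := hg
      refine Submodule.subset_span ⟨Fin.append a b, ?_⟩
      funext x
      rw [Fin.prod_univ_add]
      simp

theorem monomial_mem_homPolyFun {ι : Type} (c : ι → Module.Dual ℝ V) (d : ι →₀ ℕ) :
    (fun x => MvPolynomial.eval (fun i => c i x) (MvPolynomial.monomial d 1)) ∈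
      homPolyFun V d.degree := by
  induction d using Finsupp.induction_linear with
  | zero =>
    rw [map_zero]
    refine Submodule.subset_span ⟨fun i => i.elim0, ?_⟩
    funext x
    simp
  | add d d' hd hd' =>
    rw [map_add]
    convert homPolyFun_mul hd hd' using 1
    funext x
    rw [Pi.mul_apply, ← map_mul, MvPolynomial.monomial_mul, one_mul]
  | single i n =>
    refine Submodule.subset_span ⟨fun _ => c i, ?_⟩
    funext x
    simp [MvPolynomial.eval_monomial]

end HomogeneousPolynomials

/-! ### The action of homogeneous polynomials -/

section Action

open MvPolynomial

variable {V : Type u} [NormedAddCommGroup V] [NormedSpace ℝ V] [FiniteDimensional ℝ V]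
  {Φ : Fan V}

theorem linO_isHomogeneous (U : Φ.Opens) (h : Module.Dual ℝ V) :
    O.IsHomogeneous (linO U h) 1 :=
  fun _ _ => ⟨_, Submodule.subset_span ⟨fun _ => h, rfl⟩, fun x _ => by simp [linO_apply]⟩

theorem polyO_monomial_isHomogeneous {ι : Type} (c : ι → Module.Dual ℝ V) (U : Φ.Opens)
    (d : ι →₀ ℕ) (a : ℝ) : O.IsHomogeneous (polyO c U (monomial d a)) d.degree := by
  intro _ _
  refine ⟨_, Submodule.smul_mem _ a (monomial_mem_homPolyFun c d), fun x _ => ?_⟩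
  rw [polyO_apply, Pi.smul_apply]
  simp [eval_monomial]

variable {ι : Type} (M : GradedSheaf.{u, w} Φ) (c : ι → Module.Dual ℝ V)

theorem C_smul_mem_deg {U : Φ.Opens} {q : ℕ} (a : ℝ) {m : PolySec M c U} (hm : m ∈ M.deg U q) :
    (C a : MvPolynomial ι ℝ) • m ∈ M.deg U q := by
  have h1 := M.smul_mem_deg _ m (polyO_monomial_isHomogeneous c U 0 a) hm
  rw [map_zero, zero_add] at h1
  exact h1

theorem linO_pow_smul_mem_deg {U : Φ.Opens} {q : ℕ} (h : Module.Dual ℝ V) (r : ℕ)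
    {m : PolySec M c U} (hm : m ∈ M.deg U q) : linO U h ^ r • m ∈ M.deg U (q + r) := by
  induction r with
  | zero => rw [pow_zero, one_smul]; exact hm
  | succ r ih =>
    have h1 := M.smul_mem_deg _ _ (linO_isHomogeneous U h) ih
    rw [pow_succ', mul_smul, show q + (r + 1) = 1 + (q + r) by omega]
    exact h1

theorem polySec_smul_comm {U : Φ.Opens} (f : O U) (p : MvPolynomial ι ℝ) (m : PolySec M c U) :
    f • p • m = p • f • m := by
  rw [polySec_smul_def, polySec_smul_def, smul_smul, smul_smul, mul_comm]

/-- Multiplication by a function, as a linear map over the polynomial ring. -/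
noncomputable def mulL {U : Φ.Opens} (f : O U) :
    PolySec M c U →ₗ[MvPolynomial ι ℝ] PolySec M c U where
  toFun m := f • m
  map_add' := smul_add f
  map_smul' p m := polySec_smul_comm M c f p m

theorem mulL_apply {U : Φ.Opens} (f : O U) (m : PolySec M c U) : mulL M c f m = f • m := rfl

theorem smul_mem_augSec {U : Φ.Opens} (f : O U) {m : PolySec M c U} (hm : m ∈ augSec M c U) :
    f • m ∈ augSec M c U := by
  have h1 : (augSec M c U).map (mulL M c f) ≤ augSec M c U := by
    rw [augSec, Submodule.map_smul'']
    exact Submodule.smul_mono le_rfl le_top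
  exact h1 ⟨m, hm, rfl⟩

/-- The submodule `augSec` is spanned, as an additive group, by the products with the given
linear functionals. -/
theorem mem_closure_of_mem_augSec {U : Φ.Opens} {m : PolySec M c U} (hm : m ∈ augSec M c U) :
    m ∈ AddSubgroup.closure {z : PolySec M c U | ∃ i n, z = linO U (c i) • n} := by
  refine Submodule.smul_induction_on (p := fun m => m ∈ AddSubgroup.closure
    {z : PolySec M c U | ∃ i n, z = linO U (c i) • n}) hm (fun r hr n _ => ?_)
    fun x y hx hy => add_mem hx hy
  have hr' := mem_span_X_of_mem_ker_constantCoeff hr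
  revert n
  refine Submodule.span_induction (p := fun r _ => ∀ n : PolySec M c U, n ∈ (⊤ : Submodule
    (MvPolynomial ι ℝ) (PolySec M c U)) → r • n ∈ AddSubgroup.closure
    {z : PolySec M c U | ∃ i n, z = linO U (c i) • n}) ?_ ?_ ?_ ?_ hr'
  · rintro _ ⟨i, rfl⟩ n -
    refine AddSubgroup.subset_closure ⟨i, n, ?_⟩
    rw [polySec_smul_def, polyO, aeval_X]
  · intro n _
    rw [zero_smul]
    exact zero_mem _
  · intro x y _ _ hx hy n hn
    rw [add_smul]
    exact add_mem (hx n hn) (hy n hn)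
  · intro a x _ hx n _
    rw [smul_eq_mul, mul_comm, mul_smul]
    exact hx (a • n) trivial

/-- The submodule `augSec` is homogeneous. -/
theorem comp_mem_augSec [Fintype ι] {U : Φ.Opens} {m : PolySec M c U} (hm : m ∈ augSec M c U)
    (q : ℕ) : (show PolySec M c U from M.comp U q m) ∈ augSec M c U := by
  have hcl := mem_closure_of_mem_augSec M c hm
  clear hm
  induction hcl using AddSubgroup.closure_induction with
  | mem z hz =>
    obtain ⟨i, n, rfl⟩ := hz
    have hl := linO_isHomogeneous U (c i)
    cases q with
    | zero =>
      have h1 : M.comp U 0 (linO U (c i) • n) = 0 := M.comp_smul_of_lt hl one_pos n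
      exact (congrArg (· ∈ augSec M c U) h1).mpr (zero_mem _)
    | succ q =>
      have h1 : M.comp U (q + 1) (linO U (c i) • n) = linO U (c i) • M.comp U q n := by
        rw [add_comm]; exact M.comp_smul hl q n
      exact (congrArg (· ∈ augSec M c U) h1).mpr
        (linO_smul_mem_augSec M c (Submodule.subset_span ⟨i, rfl⟩) (M.comp U q n))
  | zero => exact (congrArg (· ∈ augSec M c U) (map_zero (M.comp U q))).mpr (zero_mem _)
  | add x y _ _ hx hy =>
    exact (congrArg (· ∈ augSec M c U) (map_add (M.comp U q) x y)).mpr (add_mem hx hy)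
  | neg x _ hx =>
    exact (congrArg (· ∈ augSec M c U) (map_neg (M.comp U q) x)).mpr (neg_mem hx)

end Action

/-! ### Generators over the polynomials on the hyperplane -/

section Generators

open MvPolynomial

variable {V : Type u} [NormedAddCommGroup V] [NormedSpace ℝ V] [FiniteDimensional ℝ V]
  {Φ : Fan V} {ι : Type} (M : GradedSheaf.{u, w} Φ) (c : ι → Module.Dual ℝ V)

theorem polyO_option_monomial (l : Module.Dual ℝ V) (U : Φ.Opens) (d : Option ι →₀ ℕ) (a : ℝ) :
    polyO (fun o : Option ι => o.elim l c) U (monomial d a) =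
      polyO c U (monomial d.some a) * linO U l ^ d none := by
  refine Subtype.ext (ContinuousMap.ext fun x => ?_)
  have h1 : (polyO c U (monomial d.some a) * linO U l ^ d none).1 x =
      (polyO c U (monomial d.some a)).1 x * l x ^ d none := rfl
  rw [h1, polyO_apply, polyO_apply, eval_monomial, eval_monomial,
    Finsupp.prod_option_index d _ (fun _ => pow_zero _) (fun _ _ _ => pow_add _ _ _)]
  simp only [Option.elim]
  ring

/-- If every function on `U` is a polynomial in the functionals `c` and one further functional
`l`, then homogeneous generators over the functions yield, by multiplication with powers of `l`,
generators over the polynomials in `c`; for a section of degree `k` no generators of degree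
larger than `k` are needed. -/
theorem mem_span_pow_smul_of_mem_deg {U : Φ.Opens} {l : Module.Dual ℝ V}
    (hsurj : Function.Surjective (polyO (fun o : Option ι => o.elim l c) U)) {κ : Type*}
    {v : κ → PolySec M c U} {p : κ → ℕ} (hv : ∀ t, v t ∈ M.deg U (p t))
    (hspan : Submodule.span (O U) (Set.range v) = ⊤) {k : ℕ} {m : PolySec M c U}
    (hm : m ∈ M.deg U k) :
    m ∈ Submodule.span (MvPolynomial ι ℝ)
      (Set.range fun t : {t : κ × ℕ // p t.1 + t.2 ≤ k} => linO U l ^ t.1.2 • v t.1.1) := by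
  set N := Submodule.span (MvPolynomial ι ℝ)
    (Set.range fun t : {t : κ × ℕ // p t.1 + t.2 ≤ k} => linO U l ^ t.1.2 • v t.1.1)
  let γ : PolySec M c U →+ PolySec M c U := M.comp U k
  -- it suffices to decompose the homogeneous components of the multiples of the generators
  have key : ∀ (r : O U) (t : κ), γ (r • v t) ∈ N := by
    intro r t
    obtain ⟨P, rfl⟩ := hsurj r
    induction P using MvPolynomial.induction_on' with
    | add P Q hP hQ => rw [map_add, add_smul, map_add]; exact add_mem hP hQ
    | monomial d a =>
      have hdeg : polyO (fun o : Option ι => o.elim l c) U (monomial d a) • v t ∈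
          M.deg U (d.degree + p t) :=
        M.smul_mem_deg _ _ (polyO_monomial_isHomogeneous _ U d a) (hv t)
      by_cases hk : d.degree + p t = k
      · have h1 : γ (polyO (fun o : Option ι => o.elim l c) U (monomial d a) • v t) =
            (monomial d.some a : MvPolynomial ι ℝ) • linO U l ^ d none • v t := by
          refine (M.comp_of_mem (hk ▸ hdeg)).trans ?_
          rw [polyO_option_monomial]
          exact mul_smul _ _ (v t)
        rw [h1]
        have h2 : d none ≤ d.degree := Finsupp.le_degree none d
        exact N.smul_mem _ (Submodule.subset_span ⟨⟨(t, d none), by dsimp only; omega⟩, rfl⟩)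
      · exact (congrArg (· ∈ N) (M.comp_of_mem_of_ne hdeg hk)).mpr (zero_mem N)
  have hm' : m ∈ Submodule.span (O U) (Set.range v) := by rw [hspan]; trivial
  obtain ⟨f, hf⟩ := (Finsupp.mem_span_range_iff_exists_finsupp).1 hm'
  have h1 : γ m = m := M.comp_of_mem hm
  rw [← h1, ← hf, Finsupp.sum, map_sum]
  exact sum_mem fun t _ => key _ t

end Generators

/-! ### Minimality of the sections over the cone -/

section Minimality

variable {V : Type u} [NormedAddCommGroup V] [NormedSpace ℝ V]
  {σ : PointedCone ℝ V} {hσ : Submodule.FG σ} {hs : (σ : ConvexCone ℝ V).Salient}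

theorem coneFan_star_self : (coneFan σ hσ hs).star (coneFan.self σ hσ hs) = ⊤ :=
  top_le_iff.1 fun τ _ => LowerSet.mem_Iic_iff.2 τ.2.le

variable {M : GradedSheaf.{u, w} (coneFan σ hσ hs)}

/-- The star of the cone is the whole fan, so the global sections are free. -/
theorem GradedSheaf.IsBasic.exists_basis_top (hM : M.IsBasic) : ∃ B : Set (M.sec ⊤),
    M.IsHomogeneousBasisOfSpan ⊤ B ∧
      Submodule.span (O (⊤ : (coneFan σ hσ hs).Opens)) B = ⊤ :=
  coneFan_star_self (hσ := hσ) (hs := hs) ▸ hM.free (coneFan.self σ hσ hs)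

/-- Minimality for the whole fan, which is the star of the cone. -/
theorem GradedSheaf.IsBasic.minimal_top (hM : M.IsBasic) (hne : σ ≠ ⊥) {B : Set (M.sec ⊤)}
    (hB : M.IsHomogeneousBasisOfSpan ⊤ B)
    (hsurj : ∀ t : M.sec (coneBdry σ hσ hs),
      ∃ m ∈ Submodule.span (O (⊤ : (coneFan σ hσ hs).Opens)) B, M.res le_top m = t) :
    Submodule.span (O (⊤ : (coneFan σ hσ hs).Opens)) B = ⊤ := by
  have key : ∀ (X : (coneFan σ hσ hs).Opens)
      (_ : (coneFan σ hσ hs).star (coneFan.self σ hσ hs) = X) (hX : coneBdry σ hσ hs ≤ X)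
      (B : Set (M.sec X)), M.IsHomogeneousBasisOfSpan X B →
      (∀ t : M.sec (coneBdry σ hσ hs), ∃ m ∈ Submodule.span (O X) B, M.res hX m = t) →
      Submodule.span (O X) B = ⊤ := by
    rintro _ rfl _
    exact hM.minimal _ fun h => hne (congrArg Subtype.val h)
  exact key ⊤ coneFan_star_self le_top B hB hsurj

/-- A member of a homogeneous basis of the sections over a cone is not congruent, on the boundary
of the cone, to a combination of the others: otherwise it could be dropped, contradicting
minimality. -/
theorem GradedSheaf.IsBasic.res_basis_ne (hM : M.IsBasic) (hne : σ ≠ ⊥) {E : Set (M.sec ⊤)}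
    (hE : M.IsHomogeneousBasisOfSpan ⊤ E)
    (hspan : Submodule.span (O (⊤ : (coneFan σ hσ hs).Opens)) E = ⊤) {t : M.sec ⊤}
    (ht : t ∈ E) {m : M.sec ⊤}
    (hm : m ∈ Submodule.span (O (⊤ : (coneFan σ hσ hs).Opens)) (E \ {t})) :
    M.res (le_top : coneBdry σ hσ hs ≤ ⊤) m ≠ M.res le_top t := by
  intro hmt
  have hsub : E \ {t} ⊆ E := Set.sdiff_subset
  have hE' : LinearIndepOn (O (⊤ : (coneFan σ hσ hs).Opens)) id (E \ {t}) :=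
    LinearIndepOn.mono (show LinearIndepOn _ id E from hE.1) hsub
  have htop : Submodule.span (O (⊤ : (coneFan σ hσ hs).Opens)) (E \ {t}) = ⊤ := by
    refine hM.minimal_top hne ⟨hE', fun b hb => hE.2 b (hsub hb)⟩
      fun y => ?_
    obtain ⟨x, rfl⟩ := hM.res_surjective (le_top : coneBdry σ hσ hs ≤ ⊤) y
    have hx : x ∈ Submodule.span (O (⊤ : (coneFan σ hσ hs).Opens)) (insert t (E \ {t})) := by
      rw [Set.insert_sdiff_singleton, Set.insert_eq_of_mem ht, hspan]
      trivial
    obtain ⟨r, z, hz, rfl⟩ := Submodule.mem_span_insert.1 hx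
    refine ⟨r • m + z, add_mem (Submodule.smul_mem _ r hm) hz, ?_⟩
    rw [map_add, map_add, M.res_smul, M.res_smul, hmt]
  have : Nontrivial (O (⊤ : (coneFan σ hσ hs).Opens)) := by
    refine ⟨0, 1, fun h => ?_⟩
    exact zero_ne_one (congrArg (fun f : O (⊤ : (coneFan σ hσ hs).Opens) =>
      f.1 ⟨0, coneFan.self σ hσ hs, trivial, zero_mem σ⟩) h)
  refine LinearIndependent.notMem_span_image hE.1 (s := {⟨t, ht⟩}ᶜ) (x := ⟨t, ht⟩)
    (fun h => h rfl) ?_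
  have himg : (fun b : E => (b : M.sec ⊤)) '' {⟨t, ht⟩}ᶜ = E \ {t} := by
    ext x
    constructor
    · rintro ⟨y, hy, rfl⟩
      exact ⟨y.2, fun h => hy (Subtype.ext h)⟩
    · rintro ⟨hx, hxt⟩
      exact ⟨⟨x, hx⟩, fun h => hxt (congrArg Subtype.val h), rfl⟩
  rw [himg, htop]
  trivial

end Minimality

/-! ### Independence of the restricted generators -/

section Restriction

open MvPolynomial

variable {V : Type u} [NormedAddCommGroup V] [NormedSpace ℝ V] [FiniteDimensional ℝ V]
  {σ : PointedCone ℝ V} {hσ : Submodule.FG σ} {hs : (σ : ConvexCone ℝ V).Salient}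
  {e : V} (he : e ∈ interior (σ : Set V)) {l : Module.Dual ℝ V} (hle : l e = 1)
  {M : GradedSheaf.{u, w} (coneFan σ hσ hs)} {ι : Type}
  (b : Module.Basis ι ℝ (LinearMap.ker l))

/-- The restriction of the global sections to the boundary of a cone. -/
noncomputable abbrev resBdry (M : GradedSheaf.{u, w} (coneFan σ hσ hs)) :
    PolySec M (fun i => b.coord i ∘ₗ proj l e hle) ⊤ →ₗ[MvPolynomial ι ℝ] BdrySec hle M b :=
  resL M _ le_top

theorem resBdry_pow_smul (M : GradedSheaf.{u, w} (coneFan σ hσ hs)) (j : ℕ)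
    (m : PolySec M (fun i => b.coord i ∘ₗ proj l e hle) ⊤) :
    resBdry hle b M (linO (⊤ : (coneFan σ hσ hs).Opens) l ^ j • m) =
      linO (coneBdry σ hσ hs) l ^ j • resBdry hle b M m :=
  (M.res_smul _ _ _).trans (by rw [map_pow, res_linO]; rfl)

variable [Fintype ι]

/-- The coordinates on the hyperplane together with the functional `ℓ` separate the points. -/
theorem polyO_option_surjective : Function.Surjective
    (polyO (fun o : Option ι => o.elim l fun i => b.coord i ∘ₗ proj l e hle)
      (⊤ : (coneFan σ hσ hs).Opens)) := by
  have h := polyO_star_surjective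
    (fun o : Option ι => o.elim l fun i => b.coord i ∘ₗ proj l e hle)
    (coneFan.self σ hσ hs) fun x _ h0 => by
      have h1 : proj l e hle x = 0 := b.ext_elem fun i => (h0 (some i)).trans (by simp)
      have h2 : l x = 0 := h0 none
      have h3 := congrArg Subtype.val h1
      rw [proj_apply, h2, zero_smul, sub_zero] at h3
      exact h3
  rwa [coneFan_star_self] at h

variable {E : Set (M.sec ⊤)} {p : E → ℕ} (hp : ∀ t : E, t.1 ∈ M.deg ⊤ (p t))
  (hspan : Submodule.span (O (⊤ : (coneFan σ hσ hs).Opens)) E = ⊤)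

include hle b hp hspan in
/-- Sections of degree smaller than that of a generator are combinations of the other
generators. -/
theorem mem_span_diff_of_mem_deg {t : E} {q : ℕ} (hq : q < p t) {m : M.sec ⊤}
    (hm : m ∈ M.deg ⊤ q) :
    m ∈ Submodule.span (O (⊤ : (coneFan σ hσ hs).Opens)) (E \ {t.1}) := by
  have h1 := mem_span_pow_smul_of_mem_deg M _
    (polyO_option_surjective (hσ := hσ) (hs := hs) hle b)
    (v := fun t : E => t.1) hp
    ((congrArg (Submodule.span _) Subtype.range_coe).trans hspan) hm
  refine Submodule.span_induction (R := MvPolynomial ι ℝ)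
    (M := PolySec M (fun i => b.coord i ∘ₗ proj l e hle) ⊤)
    (p := fun m _ => m ∈ Submodule.span (O (⊤ : (coneFan σ hσ hs).Opens)) (E \ {t.1}))
    ?_ (zero_mem _) (fun _ _ _ _ => add_mem) (fun f _ _ h => Submodule.smul_mem _ _ h) h1
  rintro _ ⟨⟨⟨t', j⟩, hj⟩, rfl⟩
  refine Submodule.smul_mem (M := M.sec ⊤) _ (linO ⊤ l ^ j)
    (Submodule.subset_span ⟨t'.2, fun h => ?_⟩)
  have : t' = t := Subtype.ext h
  dsimp only at hj
  rw [this] at hj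
  omega

include hp hspan in
/-- Minimality: generators of the same degree remain independent after restriction to the boundary
and reduction modulo all products with linear functionals. -/
theorem eq_zero_of_sum_mem_sup (hM : M.IsBasic) (hne : σ ≠ ⊥)
    (hE : M.IsHomogeneousBasisOfSpan ⊤ E) {α : Type*} {s : Finset α} {g : α → E}
    (hg : Set.InjOn g s) {P : ℕ} (hP : ∀ i ∈ s, p (g i) = P) {a : α → ℝ}
    (h : ∑ i ∈ s, (C (a i) : MvPolynomial ι ℝ) • resBdry hle b M (g i).1 ∈
      bdryAug hle M b ⊔ LinearMap.range (mulL M _ (linO (coneBdry σ hσ hs) l))) {i₀ : α}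
    (hi₀ : i₀ ∈ s) : a i₀ = 0 := by
  classical
  by_contra ha
  -- the restrictions of the combinations of the other generators
  let N : Submodule (MvPolynomial ι ℝ) (BdrySec hle M b) :=
    { ((Submodule.span (O (⊤ : (coneFan σ hσ hs).Opens)) (E \ {(g i₀).1})).toAddSubgroup.map
        (M.res (le_top : coneBdry σ hσ hs ≤ ⊤))) with
      smul_mem' := by
        rintro f _ ⟨m, hm, rfl⟩
        exact ⟨polyO (fun i => b.coord i ∘ₗ proj l e hle) ⊤ f • m, Submodule.smul_mem _ _ hm,
          (resBdry hle b M).map_smul f m⟩ }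
  let γ : BdrySec hle M b →+ BdrySec hle M b := M.comp (coneBdry σ hσ hs) P
  -- the part of degree `P` of a product with a functional comes from sections of degree below `P`
  have hlin : ∀ (f : Module.Dual ℝ V) (n : BdrySec hle M b),
      γ (linO (coneBdry σ hσ hs) f • n) ∈ N := by
    intro f n
    have hf := linO_isHomogeneous (coneBdry σ hσ hs) f
    rcases hP' : P with _ | q
    · have h1 : γ (linO (coneBdry σ hσ hs) f • n) = 0 :=
        M.comp_smul_of_lt hf (by omega) n
      rw [h1]
      exact zero_mem N
    · obtain ⟨x, rfl⟩ := hM.res_surjective (le_top : coneBdry σ hσ hs ≤ ⊤) n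
      refine ⟨linO ⊤ f • M.comp ⊤ q x, Submodule.smul_mem _ _ (mem_span_diff_of_mem_deg hle b hp
        hspan (by rw [hP i₀ hi₀]; omega) (M.comp_mem ⊤ q x)), ?_⟩
      have h1 : γ (linO (coneBdry σ hσ hs) f • M.res le_top x) =
          linO (coneBdry σ hσ hs) f • M.comp _ q (M.res le_top x) := by
        have := M.comp_smul hf q (M.res (le_top : coneBdry σ hσ hs ≤ ⊤) x)
        rwa [add_comm, ← hP'] at this
      refine Eq.trans ?_ h1.symm
      exact (M.res_smul _ _ _).trans
        (congrArg (linO (coneBdry σ hσ hs) f • ·) (M.res_comp _ _ _))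
  have hγ : ∀ z ∈ bdryAug hle M b ⊔ LinearMap.range (mulL M _ (linO (coneBdry σ hσ hs) l)),
      γ z ∈ N := by
    intro z hz
    obtain ⟨z₁, hz₁, _, ⟨n, rfl⟩, rfl⟩ := Submodule.mem_sup.1 hz
    rw [map_add]
    refine add_mem ?_ (hlin l n)
    have hle' : AddSubgroup.closure {z : BdrySec hle M b | ∃ i n,
        z = linO (coneBdry σ hσ hs) (b.coord i ∘ₗ proj l e hle) • n} ≤
        N.toAddSubgroup.comap γ := by
      rw [AddSubgroup.closure_le]
      rintro _ ⟨i, n, rfl⟩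
      exact hlin _ n
    exact hle' (mem_closure_of_mem_augSec M _ hz₁)
  have hsum := hγ _ h
  have hhom : γ (∑ i ∈ s, (C (a i) : MvPolynomial ι ℝ) • resBdry hle b M (g i).1) =
      ∑ i ∈ s, (C (a i) : MvPolynomial ι ℝ) • resBdry hle b M (g i).1 := by
    rw [map_sum]
    refine Finset.sum_congr rfl fun i hi => M.comp_of_mem (C_smul_mem_deg M _ _ ?_)
    have h1 := M.res_mem_deg (le_top : coneBdry σ hσ hs ≤ ⊤) _ (hp (g i))
    rwa [hP i hi] at h1
  rw [hhom, ← Finset.add_sum_erase _ _ hi₀] at hsum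
  have hrest : ∑ i ∈ s.erase i₀, (C (a i) : MvPolynomial ι ℝ) • resBdry hle b M (g i).1 ∈ N := by
    refine sum_mem fun i hi => N.smul_mem _ ⟨(g i).1, Submodule.subset_span ⟨(g i).2, ?_⟩, rfl⟩
    rw [Finset.mem_erase] at hi
    exact fun h => hi.1 (hg hi.2 hi₀ (Subtype.ext h))
  have h2 := (N.add_mem_iff_left hrest).1 hsum
  have h3 := N.smul_mem (C (a i₀)⁻¹) h2
  rw [smul_smul, ← C_mul, inv_mul_cancel₀ ha, C_1, one_smul] at h3
  obtain ⟨m, hm, hmt⟩ := h3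
  exact hM.res_basis_ne hne hE hspan (g i₀).2 hm hmt

include he hp hspan in
/-- Hard Lefschetz: the products of the restricted generators with powers of `ℓ` of total degree
at most `(n + 1) / 2`, where `n` is the dimension of the hyperplane, are linearly independent
modulo the products with the linear functionals of the hyperplane. -/
theorem eq_zero_of_sum_mem_bdryAug
    (hHL : HardLefschetz.{u, w} (boundaryFan σ hσ hs l e he hle) (linkPolytope σ l e hle))
    (hM : M.IsBasic) (hne : σ ≠ ⊥) (hE : M.IsHomogeneousBasisOfSpan ⊤ E) {k : ℕ}
    (hk : 2 * k ≤ Fintype.card ι + 1) (a : {t : E × ℕ // p t.1 + t.2 ≤ k} →₀ ℝ)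
    (h : (a.sum fun t r => (C r : MvPolynomial ι ℝ) •
      linO (coneBdry σ hσ hs) l ^ t.1.2 • resBdry hle b M t.1.1.1) ∈ bdryAug hle M b) :
    a = 0 := by
  classical
  by_contra ha
  obtain ⟨t₀, ht₀⟩ := Finsupp.support_nonempty_iff.2 ha
  set S := linO (coneBdry σ hσ hs) l
  obtain ⟨q, hq⟩ : ∃ q, q = p t₀.1.1 + t₀.1.2 := ⟨_, rfl⟩
  have hgen : ∀ t : E, resBdry hle b M t.1 ∈ M.deg (coneBdry σ hσ hs) (p t) := fun t =>
    M.res_mem_deg (le_top : coneBdry σ hσ hs ≤ ⊤) _ (hp t)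
  -- only the terms of degree `q` matter
  let T := a.support.filter fun t => p t.1.1 + t.1.2 = q
  have hT : ∀ t ∈ T, p t.1.1 + t.1.2 = q := fun t ht => (Finset.mem_filter.1 ht).2
  obtain ⟨t₁, ht₁, hmax⟩ := T.exists_max_image (fun t => p t.1.1)
    ⟨t₀, Finset.mem_filter.2 ⟨ht₀, hq.symm⟩⟩
  obtain ⟨P, hP⟩ : ∃ P, P = p t₁.1.1 := ⟨_, rfl⟩
  rw [← hP] at hmax
  have hPq : P ≤ q := by have := hT t₁ ht₁; omega
  have hqk : q ≤ k := by have := t₀.2; omega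
  have hz : ∑ t ∈ T, (C (a t) : MvPolynomial ι ℝ) • S ^ t.1.2 • resBdry hle b M t.1.1.1 ∈
      bdryAug hle M b := by
    have h1 := comp_mem_augSec M _ h q
    let γ : BdrySec hle M b →+ BdrySec hle M b := M.comp (coneBdry σ hσ hs) q
    have h2 : γ (a.sum fun t r => (C r : MvPolynomial ι ℝ) • S ^ t.1.2 •
        resBdry hle b M t.1.1.1) =
        ∑ t ∈ T, (C (a t) : MvPolynomial ι ℝ) • S ^ t.1.2 • resBdry hle b M t.1.1.1 := by
      rw [Finsupp.sum, map_sum, Finset.sum_filter]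
      refine Finset.sum_congr rfl fun t _ => ?_
      have h3 := C_smul_mem_deg M _ (a t) (linO_pow_smul_mem_deg M _ l t.1.2 (hgen t.1.1))
      split_ifs with hd
      · rw [hd] at h3
        exact M.comp_of_mem h3
      · exact M.comp_of_mem_of_ne h3 hd
    rw [← h2]
    exact h1
  -- divide by the largest possible power of the functional
  obtain ⟨y, hy⟩ : ∃ y : BdrySec hle M b, y = ∑ t ∈ T, (C (a t) : MvPolynomial ι ℝ) •
    S ^ (P - p t.1.1) • resBdry hle b M t.1.1.1 := ⟨_, rfl⟩
  have hydeg : y ∈ M.deg (coneBdry σ hσ hs) P := by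
    rw [hy]
    refine AddSubgroup.sum_mem (G := BdrySec hle M b) _ fun t ht => ?_
    have h3 := C_smul_mem_deg M _ (a t) (linO_pow_smul_mem_deg M _ l (P - p t.1.1) (hgen t.1.1))
    rwa [Nat.add_sub_cancel' (hmax t ht)] at h3
  have hyz : S ^ (q - P) • y ∈ bdryAug hle M b := by
    convert hz using 1
    rw [hy, Finset.smul_sum]
    refine Finset.sum_congr rfl fun t ht => ?_
    rw [polySec_smul_comm, smul_smul, ← pow_add]
    have h1 := hT t ht
    have h2 := hmax t ht
    rw [show q - P + (P - p t.1.1) = t.1.2 by omega]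
  have hyaug : y ∈ bdryAug hle M b := by
    rcases hPq.eq_or_lt with heq | hlt
    · rwa [heq, Nat.sub_self, pow_zero, one_smul] at hyz
    · -- the exponent `q - P` is at most `n - 2 * P`, as `q ≤ k` and `P < k`
      refine hardLefschetz_bdry he hle M b hHL hM (by omega) hydeg ?_
      rw [show Fintype.card ι - 2 * P = (Fintype.card ι - 2 * P - (q - P)) + (q - P) by omega,
        pow_add, mul_smul]
      exact smul_mem_augSec M _ _ hyz
  -- the remaining terms of top degree contradict minimality
  let T' := T.filter fun t => p t.1.1 = P
  have hT' : ∀ t ∈ T', p t.1.1 = P := fun t ht => (Finset.mem_filter.1 ht).2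
  have hrest : ∑ t ∈ T.filter (fun t => ¬ p t.1.1 = P), (C (a t) : MvPolynomial ι ℝ) •
      S ^ (P - p t.1.1) • resBdry hle b M t.1.1.1 ∈ LinearMap.range (mulL M _ S) := by
    refine sum_mem fun t ht => Submodule.smul_mem _ _ ?_
    rw [Finset.mem_filter] at ht
    have h1 := hmax t ht.1
    refine ⟨S ^ (P - p t.1.1 - 1) • resBdry hle b M t.1.1.1, ?_⟩
    rw [mulL_apply, smul_smul, ← pow_succ', show P - p t.1.1 - 1 + 1 = P - p t.1.1 by omega]
  have hmain : ∑ t ∈ T', (C (a t) : MvPolynomial ι ℝ) • resBdry hle b M t.1.1.1 ∈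
      bdryAug hle M b ⊔ LinearMap.range (mulL M _ S) := by
    have h1 : ∑ t ∈ T', (C (a t) : MvPolynomial ι ℝ) • resBdry hle b M t.1.1.1 =
        ∑ t ∈ T', (C (a t) : MvPolynomial ι ℝ) •
          S ^ (P - p t.1.1) • resBdry hle b M t.1.1.1 := by
      refine Finset.sum_congr rfl fun t ht => ?_
      rw [hT' t ht, Nat.sub_self, pow_zero, one_smul]
    have h2 := Finset.sum_filter_add_sum_filter_not T (fun t => p t.1.1 = P) fun t =>
      (C (a t) : MvPolynomial ι ℝ) • S ^ (P - p t.1.1) • resBdry hle b M t.1.1.1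
    rw [h1, eq_sub_of_add_eq h2, ← hy]
    exact sub_mem (Submodule.mem_sup_left hyaug) (Submodule.mem_sup_right hrest)
  have ht₁' : t₁ ∈ T' := Finset.mem_filter.2 ⟨ht₁, hP.symm⟩
  refine Finsupp.mem_support_iff.1 (Finset.mem_filter.1 ht₁).1
    (eq_zero_of_sum_mem_sup hle b hp hspan hM hne hE (g := fun t => t.1.1) ?_ hT' hmain ht₁')
  intro t ht t' ht' htt'
  have h1 := hT t (Finset.mem_filter.1 ht).1
  have h2 := hT t' (Finset.mem_filter.1 ht').1
  have h3 : t.1.1 = t'.1.1 := htt'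
  refine Subtype.ext (Prod.ext h3 ?_)
  rw [h3] at h1
  omega

end Restriction

/-! ### The kernel of the restriction -/

section Kernel

open MvPolynomial

variable {V : Type u} [NormedAddCommGroup V] [NormedSpace ℝ V] [FiniteDimensional ℝ V]
  {σ : PointedCone ℝ V} {hσ : Submodule.FG σ} {hs : (σ : ConvexCone ℝ V).Salient}

/-- The kernel of the restriction to the boundary vanishes in low degrees, because there the
sections are combinations, over the polynomials on the hyperplane, of products which remain
independent on the boundary. -/
theorem eq_zero_of_res_eq_zero {e : V} (he : e ∈ interior (σ : Set V)) {l : Module.Dual ℝ V}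
    (hle : l e = 1)
    (hHL : HardLefschetz.{u, w} (boundaryFan σ hσ hs l e he hle) (linkPolytope σ l e hle))
    {M : GradedSheaf.{u, w} (coneFan σ hσ hs)} (hM : M.IsBasic) {k : ℕ}
    (hk : 2 * k ≤ Module.finrank ℝ (LinearMap.ker l) + 1) {m : M.sec ⊤} (hmk : m ∈ M.deg ⊤ k)
    (hm : M.res (le_top : coneBdry σ hσ hs ≤ ⊤) m = 0) : m = 0 := by
  have hne : σ ≠ ⊥ := by
    rintro rfl
    have he' : e ∈ (⊥ : PointedCone ℝ V) := interior_subset he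
    rw [Submodule.mem_bot] at he'
    simp [he'] at hle
  let b := Module.finBasis ℝ (LinearMap.ker l)
  obtain ⟨E, hE, hspan⟩ := hM.exists_basis_top
  choose p hp using fun t : E => hE.2 t.1 t.2
  have := projective_bdry he hle M hM b
  have hli := linearIndependent_of_projective
    (fun t : {t : E × ℕ // p t.1 + t.2 ≤ k} =>
      linO (coneBdry σ hσ hs) l ^ t.1.2 • resBdry hle b M t.1.1.1)
    (eq_zero_of_sum_mem_bdryAug he hle b hp hspan hHL hM hne hE (by simpa using hk))
  have hmem := mem_span_pow_smul_of_mem_deg M _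
    (polyO_option_surjective (hσ := hσ) (hs := hs) hle b)
    (v := fun t : E => t.1) hp
    ((congrArg (Submodule.span _) Subtype.range_coe).trans hspan) hmk
  obtain ⟨f, rfl⟩ := Finsupp.mem_span_range_iff_exists_finsupp.1 hmem
  have hres : resBdry hle b M (f.sum fun t r => r • linO ⊤ l ^ t.1.2 • t.1.1.1) = 0 := hm
  rw [Finsupp.sum, map_sum] at hres
  have hf : f = 0 := linearIndependent_iff.1 hli f (by
    rw [Finsupp.linearCombination_apply, ← hres]
    refine Finset.sum_congr rfl fun t _ => ?_
    rw [map_smul]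
    exact congrArg (f t • ·) (resBdry_pow_smul hle b M t.1.2 t.1.1.1).symm)
  subst hf
  exact Finsupp.sum_zero_index

end Kernel

end CombIH

theorem mainTheorem9 {V : Type u} [NormedAddCommGroup V] [NormedSpace ℝ V]
    [FiniteDimensional ℝ V] (σ : PointedCone ℝ V) (hσ : Submodule.FG σ)
    (hs : (σ : ConvexCone ℝ V).Salient) (e : V) (he : e ∈ interior (σ : Set V))
    (l : Module.Dual ℝ V) (hle : l e = 1)
    (hHL : CombIH.HardLefschetz.{u, w} (CombIH.boundaryFan σ hσ hs l e he hle)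
      (CombIH.linkPolytope σ l e hle))
    (M : CombIH.GradedSheaf.{u, w} (CombIH.coneFan σ hσ hs)) (hM : M.IsBasic)
    (k : ℕ) (hk : (k : ℝ) ≤ (Module.finrank ℝ V : ℝ) / 2)
    (m : M.sec ⊤) (hmk : m ∈ M.deg ⊤ k)
    (hm : M.res (le_top :
      (CombIH.coneFan σ hσ hs).bdry (CombIH.coneFan.self σ hσ hs) ≤ ⊤) m = 0) :
    m = 0 := by
  have hl : l ≠ 0 := by
    rintro rfl
    simp at hle
  have hn := Module.Dual.finrank_ker_add_one_of_ne_zero hl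
  refine CombIH.eq_zero_of_res_eq_zero he hle hHL hM ?_ hmk hm
  rw [hn]
  have : ((2 * k : ℕ) : ℝ) ≤ Module.finrank ℝ V := by
    push_cast
    linarith
  exact_mod_cast this
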